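/- Let $K\subset\mathbb C$ be $\mathbb Q$ or an imaginary quadratic field, and let $\mathbb Z_K$ be its ring of integers. Let $q=a/b$ with $a,b\in\mathbb Z_K$ and $|q|>1$, and put $\gamma=\frac{\log|b|}{\log|a|}$. Let $s,m\ge 1$ be integers, let $P\in K[z]$ with $\deg P\le s$ and $P(0)\neq 0$, let $Q_1,\dots,Q_m\in K[z]$ be non-zero polynomials, and let $\alpha_1,\dots,\alpha_m\in K\setminus\{0\}$ satisfy $\alpha_i\neq\alpha_jq^{l}$ for all $i\neq j$ and all $l\in\mathbb Z$. For $i=1,\dots,m$ let $f_i$ be the analytic solution of the $q$-difference equation $$\alpha_i z^s f_i(z)=P(z)f_i(qz)+Q_i(z),$$ that is, the solution analytic at the origin, continued analytically to $\mathbb C\setminus\{q^k\beta : P(\beta)=0,\ k\ge 1\}$. Suppose that none of $f_1,\dots,f_m$ is a polynomial. Let $\alpha\in K\setminus\{0\}$ satisfy $P(\alpha q^{-k})\neq 0$ for $k=1,2,\dots$. For real numbers $\delta_0$ with $0<\delta_0<1$ and $\rho_0$ put $$\gamma_1=\frac{(2-\delta_0)^2(1-\delta_0)}{2\delta_0},\qquad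 \gamma_2=\gamma_1+\rho_0+\delta_0+\tfrac12\bigl(1+s(\rho_0+\delta_0)^2\bigr),\qquad \gamma_3=\gamma_1+\tfrac12+\frac{\delta_0\rho_0}{m},$$ $$\gamma_4=\gamma_3+\gamma(\rho_0+\delta_0)\Bigl(1-\frac{\delta_0}{m}+s\,\frac{\rho_0+\delta_0}{2}\Bigr),\qquad \gamma_5=\rho_0-\gamma(\rho_0+\delta_0),$$ and suppose that $$\rho_0>\frac{m(\gamma_1+\frac12)}{1-\delta_0}\qquad\text{and}\qquad \gamma<\frac{\rho_0-m\gamma_3}{(\rho_0+\delta_0)\bigl(1+\frac{sm(\rho_0+\delta_0)}{2}+m-\delta_0\bigr)}.$$ Then for every $\varepsilon_0>0$ there exists a constant $C_0>0$ such that for all $(l_0,l_1,\dots,l_m)\in\mathbb Z_K^{m+1}\setminus\{(0,\dots,0)\}$ $$|l_0+l_1f_1(\alpha)+\cdots+l_mf_m(\alpha)|>C_0\,(H_1H_2\cdots H_m)^{-\gamma_2/(\gamma_5-m\gamma_4)-\varepsilon_0},\qquad H_i=\max\{1,|l_i|\}.$$ -/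

import Mathlib

open scoped Polynomial NumberField

/-- `K ⊆ ℂ` is the field of rational numbers or an imaginary quadratic field. -/
def IsRatOrImagQuadratic (K : IntermediateField ℚ ℂ) : Prop :=
  K = ⊥ ∨ (Module.finrank ℚ K = 2 ∧ ∃ x ∈ K, x.im ≠ 0)

/-- The set `{q ^ k * β | P(β) = 0, k ≥ 1}`, outside of which the solutions of
`c z ^ s f(z) = P(z) f(q z) + Q(z)` analytic at the origin continue analytically. -/
def poleSet {K : IntermediateField ℚ ℂ} (q : K) (P : K[X]) : Set ℂ :=
  {z | ∃ k : ℕ, 1 ≤ k ∧ ∃ β : ℂ, Polynomial.aeval β P = 0 ∧ z = (q : ℂ) ^ k * β}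

/-- `f` is the analytic solution of `c z ^ s f(z) = P(z) f(q z) + Q(z)`, continued to the
complement of `poleSet q P`. When `P(0) ≠ 0` the complement is a neighbourhood of `0`.
If `q z` is not in `poleSet q P`, then neither is `z`, so the equation involves
only values of `f` on that complement; the values of `f` on `poleSet q P` are irrelevant. -/
structure IsAnalyticSolution {K : IntermediateField ℚ ℂ} (q c : K) (s : ℕ) (P Q : K[X])
    (f : ℂ → ℂ) : Prop where
  analytic : AnalyticOnNhd ℂ f (poleSet q P)ᶜ
  equation : ∀ z : ℂ, (q : ℂ) * z ∉ poleSet q P →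
    (c : ℂ) * z ^ s * f z = Polynomial.aeval z P * f ((q : ℂ) * z) + Polynomial.aeval z Q

/-! This is Siegel's method, with the functional equation itself supplying further approximations.
Write λ = log|a|, so that |q| = exp((1-γ)λ), and let F_i be the formal power series solution of the
i-th equation. Its n-th coefficient has denominator a^(n(n+1)/2) up to geometric factors, so all
sizes are of the form exp(const·λn² + O(n)).

Siegel's lemma (`exists_approximation`) gives a nonzero integral polynomial A of degree at most n
and polynomials B_i such that A F_i - B_i vanishes at 0 to order n+ν_i+1. The weights ν_i are free
apart from M = Σν_i ≈ (1-δ₀)n, and A has size about exp(λγ₁n²). Iterating the functional equation k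
times turns (A, B_i) into new approximations whose remainder at α is, up to an explicit small
factor, the old remainder at α/q^k (`denomIter_mul_sub_numerIter`). With k between ρ₀n and (ρ₀+δ₀)n
+ O(1), this beats the denominators.

Some k in this window must give a form not annihilating the vector l. The determinant of the first
m+1 iterates is nonzero (`approxDet_ne_zero`): otherwise linear algebra over ℂ(z) produces a
rational, hence polynomial, solution of one of the equations, and f_i would be that polynomial. The
determinant has degree at most (m+1)n + O(1) and vanishes at 0 to order mn+M+m, so it has at most
n-M+O(1) ≈ δ₀n nonzero zeros. If l annihilated the rows for every k in a longer window, then α/q^k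
would be a zero for too many k (`exists_sum_approxRow_ne_zero`).

Finally (`exists_linear_form_lower_bound`), n is chosen with λ(γ₅-mγ₄)n² ≈ log(H_1⋯H_m) and the ν_i
according to log H_i, so that every |l_i(p f_i(α) - p'_i)| is at most 1/(2m). The integer l_0 p + Σ
l_i p'_i is nonzero, so it has modulus at least 1. Hence |p|·|Λ| ≥ 1/2, where Λ is the linear form
to be bounded, and |p| ≤ exp(λγ₂n² + O(n)) gives the exponent. -/

/-! ### Arithmetic of the ring of integers: Siegel's lemma and common denominators. -/

/-- A discrete subring of `ℂ` over which Siegel's lemma on small solutions of linear systems holds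
with the exponent of the rational integers. -/
structure IsSiegelRing (R : Subring ℂ) : Prop where
  one_le_norm : ∀ x ∈ R, x ≠ 0 → 1 ≤ ‖x‖
  siegel : ∃ c : ℝ, 1 ≤ c ∧ ∀ (ι κ : Type) [Fintype ι] [Fintype κ] (a : ι → κ → ℂ) (A : ℝ),
    1 ≤ A → (∀ i j, a i j ∈ R) → (∀ i j, ‖a i j‖ ≤ A) → 0 < Fintype.card ι →
    Fintype.card ι < Fintype.card κ →
    ∃ x : κ → ℂ, x ≠ 0 ∧ (∀ j, x j ∈ R) ∧ (∀ i, ∑ j, a i j * x j = 0) ∧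
      ∀ j, ‖x j‖ ≤ c * (c * Fintype.card κ * A) ^
        ((Fintype.card ι : ℝ) / (Fintype.card κ - Fintype.card ι))

/-- The ring of integers of `K`, as a subring of `ℂ`. -/
noncomputable def integersInComplex (K : IntermediateField ℚ ℂ) : Subring ℂ :=
  ((algebraMap K ℂ).comp (algebraMap (𝓞 K) K)).range

namespace IsRatOrImagQuadratic

variable {K : IntermediateField ℚ ℂ}

theorem numberField (hK : IsRatOrImagQuadratic K) : NumberField K := by
  have : FiniteDimensional ℚ K := by
    rcases hK with rfl | ⟨h, -⟩
    · infer_instance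
    · exact Module.finite_of_finrank_eq_succ h
  exact NumberField.mk

/-- The only embeddings are the inclusion and, in the quadratic case, its complex conjugate. This is
where the restriction on K enters: the house of an element is its usual absolute value. -/
theorem norm_embedding (hK : IsRatOrImagQuadratic K) (φ : K →+* ℂ) (x : K) :
    ‖φ x‖ = ‖(x : ℂ)‖ := by
  have := hK.numberField
  rcases hK with rfl | ⟨h, y, hy, hyi⟩
  · obtain ⟨r, hr⟩ := IntermediateField.mem_bot.1 x.2
    have hx : x = algebraMap ℚ _ r := Subtype.ext hr.symm
    rw [hx]
    simp
  · classical
    let φ₀ : K →+* ℂ := algebraMap K ℂ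
    let φ₁ : K →+* ℂ := (starRingEnd ℂ).comp φ₀
    have hne : φ₀ ≠ φ₁ := by
      intro he
      have h1 := congrArg (fun g : K →+* ℂ => (g ⟨y, hy⟩).im) he
      have h2 : y.im = -y.im := by simpa [φ₀, φ₁] using h1
      exact hyi (by linarith)
    have hcard : Fintype.card (K →+* ℂ) = 2 := by
      rw [NumberField.Embeddings.card K ℂ, h]
    have huniv : ({φ₀, φ₁} : Finset (K →+* ℂ)) = Finset.univ := by
      apply Finset.eq_univ_of_card
      rw [Finset.card_pair hne, hcard]
    have hmem : φ ∈ ({φ₀, φ₁} : Finset (K →+* ℂ)) := huniv ▸ Finset.mem_univ φ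
    rcases Finset.mem_insert.1 hmem with rfl | h'
    · rfl
    · rw [Finset.mem_singleton.1 h']
      simp [φ₁, φ₀]

theorem house_eq [NumberField K] (hK : IsRatOrImagQuadratic K) (x : K) :
    NumberField.house x = ‖(x : ℂ)‖ := by
  rw [NumberField.house_eq_sup']
  have : (fun φ : K →+* ℂ => ‖φ x‖₊) = fun _ => ‖(x : ℂ)‖₊ := by
    funext φ
    exact NNReal.eq (hK.norm_embedding φ x)
  rw [this, Finset.sup'_const]
  rfl

theorem isSiegelRing (hK : IsRatOrImagQuadratic K) : IsSiegelRing (integersInComplex K) := by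
  have := hK.numberField
  classical
  refine ⟨?_, ?_⟩
  · rintro _ ⟨x, rfl⟩ hx
    have hx0 : (x : K) ≠ 0 := by
      intro h
      apply hx
      simp [h]
    have h := NumberField.one_le_house_of_isIntegral x.2 hx0
    rw [hK.house_eq] at h
    exact h
  -- The constant of the library's Siegel lemma is hidden behind an existential; it depends on K
  -- only, not on the system.
  · have key : ∃ c : ℝ, ∀ (ι κ : Type) [Fintype ι] [Fintype κ] (a : Matrix ι κ (𝓞 K)) (A : ℝ),
        a ≠ 0 → (∀ i j, NumberField.house ((algebraMap (𝓞 K) K) (a i j)) ≤ A) →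
        0 < Fintype.card ι → Fintype.card ι < Fintype.card κ →
        ∃ ξ : κ → 𝓞 K, ξ ≠ 0 ∧ Matrix.mulVec a ξ = 0 ∧
          ∀ l, NumberField.house (ξ l).1 ≤ c * (c * Fintype.card κ * A) ^
            ((Fintype.card ι : ℝ) / (Fintype.card κ - Fintype.card ι)) :=
      ⟨_, fun ι κ _ _ a A ha hA h0 h1 =>
        NumberField.house.exists_ne_zero_int_vec_house_le K a ha h0 h1 rfl hA rfl⟩
    obtain ⟨c, hc⟩ := key
    refine ⟨max 1 |c|, le_max_left _ _, fun ι κ _ _ a A hA haR haA h0 h1 => ?_⟩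
    choose a' ha' using haR
    have hcard : (1 : ℝ) ≤ Fintype.card κ := by exact_mod_cast (by omega : 1 ≤ Fintype.card κ)
    have hexp : 0 ≤ (Fintype.card ι : ℝ) / (Fintype.card κ - Fintype.card ι) := by
      apply div_nonneg (by positivity)
      have : (Fintype.card ι : ℝ) < Fintype.card κ := by exact_mod_cast h1
      linarith
    have hC1 : 1 ≤ max 1 |c| := le_max_left _ _
    have hbase : 1 ≤ max 1 |c| * Fintype.card κ * A := by
      have := one_le_mul_of_one_le_of_one_le hC1 hcard
      exact one_le_mul_of_one_le_of_one_le this hA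
    have hlin : ∀ ξ : κ → 𝓞 K, Matrix.mulVec (Matrix.of a') ξ = 0 →
        ∀ i, ∑ j, a i j * ((ξ j : K) : ℂ) = 0 := by
      intro ξ hξ i
      have h2 := congrArg (fun v => (((v i : 𝓞 K) : K) : ℂ)) hξ
      have h3 : ∀ j, a i j = ((a' i j : K) : ℂ) := fun j => (ha' i j).symm
      simp only [h3]
      simpa [Matrix.mulVec, dotProduct] using h2
    -- The number field version assumes a nonzero matrix; for the zero matrix the all-ones vector is
    -- a small solution.
    by_cases hz : Matrix.of a' = 0
    · refine ⟨fun _ => 1, ?_, fun _ => Subring.one_mem _, ?_, fun _ => ?_⟩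
      · obtain ⟨k⟩ := Fintype.card_pos_iff.1 (lt_of_le_of_lt (Nat.zero_le _) h1)
        intro h
        exact one_ne_zero (congrFun h k)
      · intro i
        simpa using hlin (fun _ => 1) (by rw [hz]; simp) i
      · rw [norm_one]
        exact one_le_mul_of_one_le_of_one_le hC1 (Real.one_le_rpow hbase hexp)
    · obtain ⟨ξ, hξ0, hξ, hξb⟩ := hc ι κ (Matrix.of a') A hz (fun i j => by
        rw [hK.house_eq]
        have := haA i j
        rw [← ha' i j] at this
        exact this) h0 h1
      refine ⟨fun j => ((ξ j : K) : ℂ), ?_, fun j => ⟨ξ j, rfl⟩, hlin ξ hξ, fun j => ?_⟩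
      · intro h
        apply hξ0
        funext j
        have := congrFun h j
        simpa using this
      · have h2 := hξb j
        rw [hK.house_eq] at h2
        refine h2.trans ?_
        have hA0 : 0 ≤ A := by linarith
        have hcle : c ≤ max 1 |c| := (le_abs_self c).trans (le_max_right _ _)
        calc c * (c * Fintype.card κ * A) ^ _
            ≤ |c * (c * Fintype.card κ * A) ^
              ((Fintype.card ι : ℝ) / (Fintype.card κ - Fintype.card ι))| := le_abs_self _
          _ = |c| * |(c * Fintype.card κ * A) ^
              ((Fintype.card ι : ℝ) / (Fintype.card κ - Fintype.card ι))| := abs_mul _ _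
          _ ≤ max 1 |c| * (|c * Fintype.card κ * A|) ^
              ((Fintype.card ι : ℝ) / (Fintype.card κ - Fintype.card ι)) := by
            gcongr
            · exact le_max_right _ _
            · exact Real.abs_rpow_le_abs_rpow _ _
          _ ≤ _ := by
            rw [abs_mul, abs_mul, abs_of_nonneg hA0, abs_of_nonneg (by positivity : (0:ℝ) ≤ Fintype.card κ)]
            gcongr
            exact le_max_right _ _

theorem exists_common_denominator (hK : IsRatOrImagQuadratic K) (S : Finset ℂ)
    (hS : ∀ x ∈ S, x ∈ K) :
    ∃ d ∈ integersInComplex K, d ≠ 0 ∧ ∀ x ∈ S, d * x ∈ integersInComplex K := by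
  have := hK.numberField
  classical
  induction S using Finset.induction_on with
  | empty => exact ⟨1, Subring.one_mem _, one_ne_zero, by simp⟩
  | insert x S hx ih =>
    obtain ⟨d, hd, hd0, h⟩ := ih fun y hy => hS y (Finset.mem_insert_of_mem hy)
    obtain ⟨u, v, hv0, huv⟩ := IsFractionRing.div_surjective (A := 𝓞 K)
      (⟨x, hS x (Finset.mem_insert_self _ _)⟩ : K)
    have hv0' : v ≠ 0 := nonZeroDivisors.ne_zero hv0
    have hvC : (((v : 𝓞 K) : K) : ℂ) ≠ 0 := by
      simpa using hv0'
    have hvx : (((v : 𝓞 K) : K) : ℂ) * x = ((u : K) : ℂ) := by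
      have h1 : (((u : K) / (v : K) : K) : ℂ) = x := congrArg Subtype.val huv
      rw [← h1]
      push_cast
      field_simp
    refine ⟨((v : K) : ℂ) * d, Subring.mul_mem _ ⟨v, rfl⟩ hd, mul_ne_zero hvC hd0, ?_⟩
    intro y hy
    rcases Finset.mem_insert.1 hy with rfl | hy
    · have : ((v : K) : ℂ) * d * y = d * ((u : K) : ℂ) := by rw [← hvx]; ring
      rw [this]
      exact Subring.mul_mem _ hd ⟨u, rfl⟩
    · rw [mul_assoc]
      exact Subring.mul_mem _ ⟨v, rfl⟩ (h y hy)

end IsRatOrImagQuadratic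

/-! ### Linear recurrences and the formal power series solution. -/

/-- The sequence solving the recurrence `u n = ∑ j < n, w n j * u j + v n`. -/
theorem exists_linear_recurrence (w : ℕ → ℕ → ℂ) (v : ℕ → ℂ) :
    ∃ u : ℕ → ℂ, ∀ n, u n = ∑ j ∈ Finset.range n, w n j * u j + v n := by
  let F : (n : ℕ) → ((k : ℕ) → k < n → ℂ) → ℂ :=
    fun n ih => ∑ j : Fin n, w n j * ih j j.2 + v n
  refine ⟨fun n => Nat.strongRec F n, fun n => ?_⟩
  change Nat.strongRec F n = ∑ j ∈ Finset.range n, w n j * Nat.strongRec F j + v n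
  rw [Nat.strongRec_eq, Finset.sum_range (fun j => w n j * Nat.strongRec F j)]

/-- At most s earlier terms enter, each contributing at most M·C^n, so a ratio C ≥ M(s+1) closes the
induction. -/
theorem norm_linear_recurrence_le {w : ℕ → ℕ → ℂ} {v u : ℕ → ℂ}
    (hu : ∀ n, u n = ∑ j ∈ Finset.range n, w n j * u j + v n) {s : ℕ} {M : ℝ}
    (hw0 : ∀ n j, j + s < n → w n j = 0) (hw : ∀ n j, j < n → ‖w n j‖ ≤ M)
    (hv : ∀ n, ‖v n‖ ≤ M) :
    ∃ C : ℝ, 1 ≤ C ∧ ∀ n, ‖u n‖ ≤ C ^ (n + 1) := by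
  have hM : 0 ≤ M := (norm_nonneg _).trans (hv 0)
  refine ⟨max 1 (M * (s + 1)), le_max_left _ _, ?_⟩
  set C := max 1 (M * (s + 1)) with hC
  have hC1 : 1 ≤ C := le_max_left _ _
  have hC2 : M * (s + 1) ≤ C := le_max_right _ _
  intro n
  induction n using Nat.strong_induction_on with
  | _ n ih =>
    rw [hu n]
    have h1 : ∀ j ∈ Finset.range n, ‖w n j * u j‖ ≤ if n ≤ j + s then M * C ^ n else 0 := by
      intro j hj
      have hj := Finset.mem_range.1 hj
      split_ifs with h
      · rw [norm_mul]
        refine mul_le_mul (hw n j hj) ((ih j hj).trans ?_) (norm_nonneg _) hM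
        exact pow_le_pow_right₀ hC1 hj
      · rw [hw0 n j (by omega)]
        simp
    have h2 : ((Finset.range n).filter (fun j => n ≤ j + s)).card ≤ s := by
      calc _ ≤ (Finset.Ico (n - s) n).card := by
            apply Finset.card_le_card
            intro j
            simp only [Finset.mem_filter, Finset.mem_range, Finset.mem_Ico]
            omega
        _ ≤ s := by simp; omega
    calc ‖∑ j ∈ Finset.range n, w n j * u j + v n‖
        ≤ ‖∑ j ∈ Finset.range n, w n j * u j‖ + ‖v n‖ := norm_add_le _ _
      _ ≤ (∑ j ∈ Finset.range n, if n ≤ j + s then M * C ^ n else 0) + M :=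
        add_le_add (norm_sum_le_of_le _ h1) (hv n)
      _ ≤ s * (M * C ^ n) + M * C ^ n := by
        gcongr
        · rw [← Finset.sum_filter, Finset.sum_const, nsmul_eq_mul]
          have : (((Finset.range n).filter (fun j => n ≤ j + s)).card : ℝ) ≤ s := by
            exact_mod_cast h2
          gcongr
        · exact le_mul_of_one_le_right hM (one_le_pow₀ hC1)
      _ = (M * (s + 1)) * C ^ n := by ring
      _ ≤ C * C ^ n := by gcongr
      _ = C ^ (n + 1) := by ring

/-- Step n costs a factor d·a^n on top of the denominator of an earlier term, which divides that of
term n-1; the exponents of a add up to 1+⋯+n. -/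
theorem linear_recurrence_mem {R : Subring ℂ} {w : ℕ → ℕ → ℂ} {v u : ℕ → ℂ}
    (hu : ∀ n, u n = ∑ j ∈ Finset.range n, w n j * u j + v n) {a d : ℂ} (ha : a ∈ R) (hd : d ∈ R)
    (hw : ∀ n j, j < n → d * a ^ n * w n j ∈ R) (hv : ∀ n, d * a ^ n * v n ∈ R) (n : ℕ) :
    d ^ (n + 1) * a ^ (n * (n + 1) / 2) * u n ∈ R := by
  induction n using Nat.strong_induction_on with
  | _ n ih =>
    rw [hu n, mul_add, Finset.mul_sum]
    have tri : ∀ k, (k + 1) * (k + 1 + 1) / 2 = k * (k + 1) / 2 + (k + 1) := by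
      intro k
      rw [show (k + 1) * (k + 1 + 1) = k * (k + 1) + (k + 1) * 2 by ring]
      exact Nat.add_mul_div_right _ _ (by norm_num)
    have tmono : ∀ j k, j ≤ k → j * (j + 1) / 2 ≤ k * (k + 1) / 2 := by
      intro j k h
      gcongr
    refine Subring.add_mem _ (Subring.sum_mem _ fun j hj => ?_) ?_
    · have hj := Finset.mem_range.1 hj
      obtain ⟨k, rfl⟩ : ∃ k, n = k + 1 := ⟨n - 1, by omega⟩
      obtain ⟨e, he⟩ := Nat.exists_eq_add_of_le (tmono j k (by omega))
      obtain ⟨e', rfl⟩ := Nat.exists_eq_add_of_le (by omega : j ≤ k)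
      have : d ^ (j + e' + 1 + 1) * a ^ ((j + e' + 1) * (j + e' + 1 + 1) / 2) *
          (w (j + e' + 1) j * u j) = d ^ e' * a ^ e * (d * a ^ (j + e' + 1) * w (j + e' + 1) j) *
            (d ^ (j + 1) * a ^ (j * (j + 1) / 2) * u j) := by
        rw [tri, he]
        ring
      rw [this]
      exact Subring.mul_mem _ (Subring.mul_mem _ (Subring.mul_mem _ (Subring.pow_mem _ hd _)
        (Subring.pow_mem _ ha _)) (hw _ _ hj)) (ih j hj)
    · have h1 : n ≤ n * (n + 1) / 2 := by
        rcases n with _ | k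
        · simp
        · rw [tri]; omega
      obtain ⟨e, he⟩ := Nat.exists_eq_add_of_le h1
      have : d ^ (n + 1) * a ^ (n * (n + 1) / 2) * v n = d ^ n * a ^ e * (d * a ^ n * v n) := by
        rw [he]
        ring
      rw [this]
      exact Subring.mul_mem _ (Subring.mul_mem _ (Subring.pow_mem _ hd _)
        (Subring.pow_mem _ ha _)) (hv n)

/-- The formal power series `F` solves `c z ^ s F(z) = P(z) F(q z) + Q(z)`. -/
def IsFormalSolution (q c : ℂ) (s : ℕ) (P Q : ℂ[X]) (F : PowerSeries ℂ) : Prop :=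
  PowerSeries.C c * PowerSeries.X ^ s * F =
    (P : PowerSeries ℂ) * PowerSeries.rescale q F + (Q : PowerSeries ℂ)

theorem Polynomial.exists_norm_coeff_le (p : ℂ[X]) : ∃ M : ℝ, 0 ≤ M ∧ ∀ j, ‖p.coeff j‖ ≤ M := by
  refine ⟨∑ j ∈ p.support, ‖p.coeff j‖, Finset.sum_nonneg fun _ _ => norm_nonneg _, fun j => ?_⟩
  by_cases h : j ∈ p.support
  · exact Finset.single_le_sum (f := fun j => ‖p.coeff j‖) (fun _ _ => norm_nonneg _) h
  · rw [Polynomial.notMem_support_iff.1 h, norm_zero]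
    exact Finset.sum_nonneg fun _ _ => norm_nonneg _

/-- The formal solution: its coefficients grow at most geometrically, and `a ^ (n * (n + 1) / 2)`
is, up to geometric factors, a denominator of the `n`-th one. -/
theorem exists_isFormalSolution {R : Subring ℂ} {a b q c d : ℂ} (ha : a ∈ R) (hb : b ∈ R)
    (hd : d ∈ R) (hqab : b * q = a) (hq : 1 < ‖q‖) {s : ℕ} (hs : 1 ≤ s) {P Q : ℂ[X]}
    (hPs : P.natDegree ≤ s) (hP0 : P.coeff 0 ≠ 0)
    (hdc : d * (c / P.coeff 0) ∈ R) (hdP : ∀ j, d * (P.coeff j / P.coeff 0) ∈ R)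
    (hdQ : ∀ j, d * (Q.coeff j / P.coeff 0) ∈ R) :
    ∃ F : PowerSeries ℂ, IsFormalSolution q c s P Q F ∧
      (∃ C : ℝ, 1 ≤ C ∧ ∀ n, ‖F.coeff n‖ ≤ C ^ (n + 1)) ∧
      ∀ n, d ^ (n + 1) * a ^ (n * (n + 1) / 2) * F.coeff n ∈ R := by
  have hq0 : q ≠ 0 := by
    rintro rfl
    simp at hq
    linarith
  set p₀ := P.coeff 0 with hp₀
  -- Coefficient n of the equation reads c·u_(n-s) = Σ_(j≤n) P_(n-j) q^j u_j + Q_n; it is solved for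
  -- the term j = n, whose factor P_0 q^n is nonzero.
  obtain ⟨u, hu⟩ := exists_linear_recurrence
    (fun n j => (if j + s = n then c / p₀ * (q ^ n)⁻¹ else 0) -
      P.coeff (n - j) / p₀ * (q ^ j * (q ^ n)⁻¹)) (fun n => -(Q.coeff n / p₀ * (q ^ n)⁻¹))
  have hqn : ∀ n, ‖(q ^ n)⁻¹‖ ≤ 1 := by
    intro n
    rw [norm_inv, norm_pow]
    exact inv_le_one_of_one_le₀ (one_le_pow₀ hq.le)
  have hqj : ∀ n j, j < n → q ^ j * (q ^ n)⁻¹ = (q ^ (n - j))⁻¹ := by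
    intro n j hj
    obtain ⟨e, rfl⟩ := Nat.exists_eq_add_of_lt hj
    rw [show j + e + 1 - j = e + 1 by omega, show j + e + 1 = j + (e + 1) by ring, pow_add q j]
    field_simp
  -- This identity is why a^n, and not a power of both a and b, clears the division by q^n.
  have han : ∀ n, a ^ n * (q ^ n)⁻¹ = b ^ n := by
    intro n
    rw [← hqab, mul_pow]
    field_simp
  refine ⟨PowerSeries.mk u, ?_, ?_, fun n => ?_⟩
  · ext n
    have h := hu n
    rw [mul_assoc, PowerSeries.coeff_C_mul, PowerSeries.coeff_X_pow_mul', PowerSeries.coeff_mk,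
      map_add, mul_comm (P : PowerSeries ℂ), PowerSeries.coeff_mul,
      Finset.Nat.sum_antidiagonal_eq_sum_range_succ_mk, Polynomial.coeff_coe]
    simp only [PowerSeries.coeff_rescale, PowerSeries.coeff_mk, Polynomial.coeff_coe]
    rw [Finset.sum_range_succ, Nat.sub_self, ← hp₀]
    have hite : ∑ j ∈ Finset.range n, (if j + s = n then c * u j else 0) =
        c * if s ≤ n then u (n - s) else 0 := by
      split_ifs with hsn
      · rw [Finset.sum_eq_single_of_mem (n - s) (Finset.mem_range.2 (by omega))]
        · rw [if_pos (by omega)]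
        · intro j _ hj
          rw [if_neg (by omega)]
      · rw [mul_zero]
        refine Finset.sum_eq_zero fun j _ => if_neg (by omega)
    have h' : q ^ n * u n * p₀ = (∑ j ∈ Finset.range n, (if j + s = n then c * u j else 0)) -
        (∑ j ∈ Finset.range n, q ^ j * u j * P.coeff (n - j)) - Q.coeff n := by
      rw [h, ← Finset.sum_sub_distrib, mul_add, add_mul, Finset.mul_sum, Finset.sum_mul,
        sub_eq_add_neg _ (Q.coeff n)]
      congr 1
      · refine Finset.sum_congr rfl fun j _ => ?_
        split_ifs <;> field_simp
        ring
      · field_simp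
    rw [h', hite]
    ring
  · obtain ⟨M₁, hM₁, h₁⟩ := Polynomial.exists_norm_coeff_le P
    obtain ⟨M₂, hM₂, h₂⟩ := Polynomial.exists_norm_coeff_le Q
    have hM : 0 ≤ M₁ / ‖p₀‖ := by positivity
    have hM' : 0 ≤ M₂ / ‖p₀‖ := by positivity
    simp only [PowerSeries.coeff_mk]
    refine norm_linear_recurrence_le hu (s := s) (M := ‖c / p₀‖ + M₁ / ‖p₀‖ + M₂ / ‖p₀‖) ?_ ?_ ?_
    · intro n j hj
      rw [if_neg (by omega), Polynomial.coeff_eq_zero_of_natDegree_lt (by omega)]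
      simp
    · intro n j hj
      rw [hqj n j hj]
      refine (norm_sub_le _ _).trans ?_
      have e1 : ‖if j + s = n then c / p₀ * (q ^ n)⁻¹ else 0‖ ≤ ‖c / p₀‖ := by
        split_ifs
        · rw [norm_mul]
          exact mul_le_of_le_one_right (norm_nonneg _) (hqn n)
        · rw [norm_zero]
          exact norm_nonneg _
      have e2 : ‖P.coeff (n - j) / p₀ * (q ^ (n - j))⁻¹‖ ≤ M₁ / ‖p₀‖ := by
        rw [norm_mul, norm_div]
        refine (mul_le_of_le_one_right (by positivity) (hqn _)).trans ?_
        gcongr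
        exact h₁ _
      linarith
    · intro n
      rw [norm_neg, norm_mul, norm_div]
      have e2 : ‖Q.coeff n‖ / ‖p₀‖ * ‖(q ^ n)⁻¹‖ ≤ M₂ / ‖p₀‖ := by
        refine (mul_le_of_le_one_right (by positivity) (hqn _)).trans ?_
        gcongr
        exact h₂ _
      have := norm_nonneg (c / p₀)
      linarith
  · rw [PowerSeries.coeff_mk]
    refine linear_recurrence_mem hu ha hd ?_ ?_ n
    · intro n j hj
      rw [hqj n j hj, mul_sub]
      refine Subring.sub_mem _ ?_ ?_
      · split_ifs
        · have : d * a ^ n * (c / p₀ * (q ^ n)⁻¹) = d * (c / p₀) * b ^ n := by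
            rw [← han]; ring
          rw [this]
          exact Subring.mul_mem _ hdc (Subring.pow_mem _ hb _)
        · simp
      · have : d * a ^ n * (P.coeff (n - j) / p₀ * (q ^ (n - j))⁻¹) =
            d * (P.coeff (n - j) / p₀) * (b ^ (n - j) * a ^ j) := by
          rw [← han, show a ^ n = a ^ (n - j) * a ^ j by rw [← pow_add]; congr 1; omega]; ring
        rw [this]
        exact Subring.mul_mem _ (hdP _)
          (Subring.mul_mem _ (Subring.pow_mem _ hb _) (Subring.pow_mem _ ha _))
    · intro n
      have : d * a ^ n * -(Q.coeff n / p₀ * (q ^ n)⁻¹) = -(d * (Q.coeff n / p₀) * b ^ n) := by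
        rw [← han]; ring
      rw [this]
      exact Subring.neg_mem _ (Subring.mul_mem _ (hdQ n) (Subring.pow_mem _ hb _))

/-! ### Analytic estimates for remainders near the origin. -/

-- Schwarz's lemma: the maximum principle on the unit disc applied to E/X^N.
open Filter Topology in
theorem Polynomial.norm_eval_le_of_X_pow_dvd {E : ℂ[X]} {N : ℕ} {B : ℝ}
    (hE : Polynomial.X ^ N ∣ E) (hB : ∀ z : ℂ, ‖z‖ = 1 → ‖E.eval z‖ ≤ B) {z : ℂ} (hz : ‖z‖ ≤ 1) :
    ‖E.eval z‖ ≤ B * ‖z‖ ^ N := by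
  obtain ⟨G, rfl⟩ := hE
  have hG : ‖G.eval z‖ ≤ B := by
    refine Complex.norm_le_of_forall_mem_frontier_norm_le (U := Metric.ball 0 1)
      Metric.isBounded_ball G.differentiable.diffContOnCl ?_ ?_
    · intro w hw
      rw [frontier_ball _ one_ne_zero, mem_sphere_zero_iff_norm] at hw
      have := hB w hw
      simpa [hw] using this
    · rw [closure_ball _ one_ne_zero]
      simpa using hz
  rw [Polynomial.eval_mul, Polynomial.eval_pow, Polynomial.eval_X, norm_mul, norm_pow, mul_comm]
  gcongr

theorem Polynomial.norm_eval_le {p : ℂ[X]} {n : ℕ} (hn : p.natDegree ≤ n) {M : ℝ}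
    (hM : ∀ j, ‖p.coeff j‖ ≤ M) {z : ℂ} {ρ : ℝ} (hρ : 1 ≤ ρ) (hz : ‖z‖ ≤ ρ) :
    ‖p.eval z‖ ≤ (n + 1) * M * ρ ^ n := by
  have hM0 : 0 ≤ M := (norm_nonneg _).trans (hM 0)
  rw [Polynomial.eval_eq_sum_range' (Nat.lt_succ_of_le hn)]
  refine (norm_sum_le_of_le (f := fun i => p.coeff i * z ^ i) (n := fun _ => M * ρ ^ n) _
    fun i hi => ?_).trans ?_
  · rw [norm_mul, norm_pow]
    have : i ≤ n := Nat.lt_succ_iff.1 (Finset.mem_range.1 hi)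
    gcongr
    · exact hM i
    · exact (pow_le_pow_left₀ (norm_nonneg _) hz _).trans (pow_le_pow_right₀ hρ this)
  · rw [Finset.sum_const, Finset.card_range, nsmul_eq_mul]
    push_cast
    rw [mul_assoc]

theorem Polynomial.exists_norm_eval_le (p : ℂ[X]) (ρ : ℝ) :
    ∃ M : ℝ, 1 ≤ M ∧ ∀ z : ℂ, ‖z‖ ≤ ρ → ‖p.eval z‖ ≤ M := by
  obtain ⟨M, hM0, hM⟩ := p.exists_norm_coeff_le
  refine ⟨1 + (p.natDegree + 1) * M * (max 1 ρ) ^ p.natDegree, ?_, fun z hz => ?_⟩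
  · have : 0 ≤ (p.natDegree + 1) * M * (max 1 ρ) ^ p.natDegree := by positivity
    linarith
  · have := Polynomial.norm_eval_le le_rfl hM (le_max_left 1 ρ) (hz.trans (le_max_right 1 ρ))
    linarith

theorem coe_comp_C_mul_X (p : ℂ[X]) (q : ℂ) :
    ((p.comp (Polynomial.C q * Polynomial.X) : ℂ[X]) : PowerSeries ℂ) =
      PowerSeries.rescale q (p : PowerSeries ℂ) := by
  ext n
  rw [Polynomial.coeff_coe, Polynomial.comp_C_mul_X_coeff, PowerSeries.coeff_rescale,
    Polynomial.coeff_coe, mul_comm]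

theorem X_pow_dvd_coe_iff {p : ℂ[X]} {N : ℕ} :
    (PowerSeries.X ^ N : PowerSeries ℂ) ∣ p ↔ Polynomial.X ^ N ∣ p := by
  rw [PowerSeries.X_pow_dvd_iff, Polynomial.X_pow_dvd_iff]
  simp only [Polynomial.coeff_coe]

theorem X_pow_dvd_rescale {F : PowerSeries ℂ} {N : ℕ} (q : ℂ)
    (h : (PowerSeries.X ^ N : PowerSeries ℂ) ∣ F) :
    (PowerSeries.X ^ N : PowerSeries ℂ) ∣ PowerSeries.rescale q F := by
  rw [PowerSeries.X_pow_dvd_iff] at h ⊢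
  intro n hn
  rw [PowerSeries.coeff_rescale, h n hn, mul_zero]

theorem X_pow_dvd_trunc_sub (F : PowerSeries ℂ) (N : ℕ) :
    (PowerSeries.X ^ N : PowerSeries ℂ) ∣ (PowerSeries.trunc N F : PowerSeries ℂ) - F := by
  rw [PowerSeries.X_pow_dvd_iff]
  intro n hn
  rw [map_sub, Polynomial.coeff_coe, PowerSeries.coeff_trunc, if_pos hn, sub_self]

theorem norm_eval_trunc_le {F : PowerSeries ℂ} {C : ℝ} (hC : 1 ≤ C)
    (hF : ∀ n, ‖F.coeff n‖ ≤ C ^ (n + 1)) {ρ : ℝ} (hρ : 1 ≤ ρ) {z : ℂ} (hz : ‖z‖ ≤ ρ) (N : ℕ) :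
    ‖(PowerSeries.trunc N F).eval z‖ ≤ (2 * C * ρ) ^ N := by
  rw [PowerSeries.trunc_apply, Polynomial.eval_finsetSum]
  refine (norm_sum_le_of_le (n := fun _ => (C * ρ) ^ N) _ fun i hi => ?_).trans ?_
  · have hi : i + 1 ≤ N := by simpa using hi
    rw [Polynomial.eval_monomial, norm_mul, norm_pow, mul_pow]
    refine mul_le_mul ((hF i).trans (pow_le_pow_right₀ hC hi)) ?_ (by positivity) (by positivity)
    exact (pow_le_pow_left₀ (norm_nonneg _) hz _).trans (pow_le_pow_right₀ hρ (by omega))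
  · rw [Finset.sum_const, nsmul_eq_mul, show 2 * C * ρ = 2 * (C * ρ) by ring, mul_pow 2]
    have : (N : ℝ) ≤ 2 ^ N := by exact_mod_cast Nat.lt_two_pow_self.le
    simp only [Nat.Ico_zero_eq_range, Finset.card_range]
    gcongr

/-- Replacing z by z/q repeatedly halves the unknown term each time, so the crude bound M disappears
in the limit and the inhomogeneous terms sum to a geometric series. -/
theorem norm_le_of_norm_le_half_norm_div {h : ℂ → ℂ} {q : ℂ} (hq : 1 < ‖q‖) {r M K : ℝ} (hK : 0 ≤ K)
    {N : ℕ} (hM : ∀ z, ‖z‖ ≤ r → ‖h z‖ ≤ M)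
    (hh : ∀ z, ‖z‖ ≤ r → ‖h z‖ ≤ 1 / 2 * ‖h (z / q)‖ + K * ‖z‖ ^ N) {z : ℂ} (hz : ‖z‖ ≤ r) :
    ‖h z‖ ≤ 2 * K * ‖z‖ ^ N := by
  have hdiv : ∀ w : ℂ, ‖w / q‖ ≤ ‖w‖ := by
    intro w
    rw [norm_div]
    exact div_le_self (norm_nonneg _) hq.le
  have key : ∀ k : ℕ, ∀ w : ℂ, ‖w‖ ≤ r → ‖h w‖ ≤ (1 / 2) ^ k * M + 2 * K * ‖w‖ ^ N := by
    intro k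
    induction k with
    | zero =>
      intro w hw
      have := hM w hw
      have : 0 ≤ 2 * K * ‖w‖ ^ N := by positivity
      simp only [pow_zero, one_mul]
      linarith
    | succ k ih =>
      intro w hw
      have h1 := hh w hw
      have h2 := ih (w / q) ((hdiv w).trans hw)
      have h3 : 2 * K * ‖w / q‖ ^ N ≤ 2 * K * ‖w‖ ^ N := by
        gcongr
        exact hdiv w
      rw [pow_succ]
      linarith
  have hlim : Filter.Tendsto (fun k : ℕ => (1 / 2 : ℝ) ^ k * M + 2 * K * ‖z‖ ^ N) Filter.atTop
      (nhds (0 * M + 2 * K * ‖z‖ ^ N)) :=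
    ((tendsto_pow_atTop_nhds_zero_of_lt_one (by norm_num) (by norm_num)).mul_const M).add_const _
  rw [zero_mul, zero_add] at hlim
  exact ge_of_tendsto' hlim fun k => key k z hz

-- The difference of f and the truncation of F satisfies the functional equation up to a polynomial
-- divisible by X^N, and near 0 the factor c z^s / P(z) has modulus at most 1/2. Thus continuity of
-- f at 0 suffices and F need not be identified with the Taylor series of f. The radius and B do not
-- depend on N.
open Filter Topology in
theorem norm_sub_eval_trunc_le {q c : ℂ} (hq : 1 < ‖q‖) {s : ℕ} (hs : 1 ≤ s) {P Q : ℂ[X]}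
    (hP0 : P.coeff 0 ≠ 0) {F : PowerSeries ℂ} (hF : IsFormalSolution q c s P Q F) {C : ℝ}
    (hC : 1 ≤ C) (hFC : ∀ n, ‖F.coeff n‖ ≤ C ^ (n + 1)) {f : ℂ → ℂ} (hf : ContinuousAt f 0)
    (heq : ∀ᶠ z in 𝓝 (0 : ℂ), c * z ^ s * f z = P.eval z * f (q * z) + Q.eval z) :
    ∃ r : ℝ, 0 < r ∧ r ≤ 1 ∧ ∃ B : ℝ, 1 ≤ B ∧ ∀ N : ℕ, ∀ z : ℂ, ‖z‖ ≤ r →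
      ‖f z - (PowerSeries.trunc N F).eval z‖ ≤ B ^ (N + 1) * ‖z‖ ^ N := by
  have hq0 : q ≠ 0 := by
    rintro rfl
    simp at hq
    linarith
  set μ := ‖P.coeff 0‖ / 2 with hμ
  have hμ0 : 0 < μ := by positivity
  have hP1 : ∀ᶠ z in 𝓝 (0 : ℂ), μ < ‖P.eval z‖ := by
    have : ContinuousAt (fun z : ℂ => ‖P.eval z‖) 0 := P.continuous.norm.continuousAt
    refine this.eventually_const_lt ?_
    change μ < ‖P.eval 0‖
    rw [← Polynomial.coeff_zero_eq_eval_zero]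
    have : 0 < ‖P.coeff 0‖ := by positivity
    rw [hμ]; linarith
  have hc1 : ∀ᶠ z in 𝓝 (0 : ℂ), ‖c * z ^ s‖ < μ / 2 := by
    have : ContinuousAt (fun z : ℂ => ‖c * z ^ s‖) 0 := by fun_prop
    refine this.eventually_lt_const ?_
    change ‖c * 0 ^ s‖ < μ / 2
    rw [zero_pow (by omega : s ≠ 0), mul_zero, norm_zero]
    positivity
  have hf1 : ∀ᶠ z in 𝓝 (0 : ℂ), ‖f z‖ < ‖f 0‖ + 1 :=
    hf.norm.eventually_lt_const (by linarith)
  obtain ⟨r₀, hr₀, hball⟩ := Metric.eventually_nhds_iff_ball.1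
    (hP1.and (hc1.and (hf1.and heq)))
  obtain ⟨Pm, hPm1, hPm⟩ := P.exists_norm_eval_le 1
  obtain ⟨Qm, hQm1, hQm⟩ := Q.exists_norm_eval_le 1
  set D := 2 * C * ‖q‖ with hD
  have hD1 : 1 ≤ D := by
    have : 1 ≤ 2 * C := by linarith
    exact one_le_mul_of_one_le_of_one_le this hq.le
  have hCD : 2 * C * 1 ≤ D := by
    rw [hD]; gcongr
  set B₀ := ‖c‖ + Pm + Qm with hB₀
  have hB₀1 : 1 ≤ B₀ := by
    have := norm_nonneg c
    linarith
  set r := min (r₀ / 2) 1 with hr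
  have hrr : ∀ z : ℂ, ‖z‖ ≤ r → z ∈ Metric.ball (0 : ℂ) r₀ := by
    intro z hz
    rw [mem_ball_zero_iff]
    have : r ≤ r₀ / 2 := min_le_left _ _
    linarith
  refine ⟨r, by positivity, min_le_right _ _, max D (2 * (B₀ / μ)),
    hD1.trans (le_max_left _ _), fun N z hz => ?_⟩
  set T := PowerSeries.trunc N F with hT
  -- The residual of the truncated series in the functional equation.
  let E : ℂ[X] := Polynomial.C c * Polynomial.X ^ s * T -
    P * T.comp (Polynomial.C q * Polynomial.X) - Q
  have hTcomp : ∀ w, (T.comp (Polynomial.C q * Polynomial.X)).eval w = T.eval (q * w) := by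
    intro w
    simp [Polynomial.eval_comp]
  have hEe : ∀ w, E.eval w = c * w ^ s * T.eval w - P.eval w * T.eval (q * w) - Q.eval w := by
    intro w
    simp only [E, Polynomial.eval_sub, Polynomial.eval_mul, hTcomp, Polynomial.eval_C,
      Polynomial.eval_pow, Polynomial.eval_X]
  have hEX : Polynomial.X ^ N ∣ E := by
    rw [← X_pow_dvd_coe_iff]
    have : (E : PowerSeries ℂ) = PowerSeries.C c * PowerSeries.X ^ s * ((T : PowerSeries ℂ) - F) -
        (P : PowerSeries ℂ) * PowerSeries.rescale q ((T : PowerSeries ℂ) - F) := by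
      simp only [E, Polynomial.coe_sub, Polynomial.coe_mul, coe_comp_C_mul_X, Polynomial.coe_C,
        Polynomial.coe_pow, Polynomial.coe_X, mul_sub, map_sub]
      rw [show (PowerSeries.C c * PowerSeries.X ^ s * F : PowerSeries ℂ) = _ from hF]
      ring
    rw [this]
    exact dvd_sub (Dvd.dvd.mul_left (X_pow_dvd_trunc_sub F N) _)
      (Dvd.dvd.mul_left (X_pow_dvd_rescale q (X_pow_dvd_trunc_sub F N)) _)
  have hE1 : ∀ w : ℂ, ‖w‖ = 1 → ‖E.eval w‖ ≤ B₀ * D ^ N := by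
    intro w hw
    have t1 : ‖T.eval w‖ ≤ D ^ N :=
      (norm_eval_trunc_le hC hFC le_rfl hw.le N).trans (by gcongr)
    have t2 : ‖T.eval (q * w)‖ ≤ D ^ N :=
      norm_eval_trunc_le hC hFC hq.le (by rw [norm_mul, hw, mul_one]) N
    have hDN : 1 ≤ D ^ N := one_le_pow₀ hD1
    rw [hEe]
    calc _ ≤ ‖c * w ^ s * T.eval w‖ + ‖P.eval w * T.eval (q * w)‖ + ‖Q.eval w‖ :=
          (norm_sub_le _ _).trans (add_le_add (norm_sub_le _ _) le_rfl)
      _ ≤ ‖c‖ * D ^ N + Pm * D ^ N + Qm * D ^ N := by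
          rw [norm_mul, norm_mul, norm_mul, norm_pow, hw, one_pow, mul_one]
          gcongr
          · exact hPm w hw.le
          · exact (hQm w hw.le).trans (le_mul_of_one_le_right (by linarith) hDN)
      _ = B₀ * D ^ N := by rw [hB₀]; ring
  obtain ⟨TM, -, hTM⟩ := T.exists_norm_eval_le r
  have hmain := norm_le_of_norm_le_half_norm_div (h := fun w => f w - T.eval w) hq (r := r)
    (M := ‖f 0‖ + 1 + TM) (K := B₀ * D ^ N / μ) (by positivity) (N := N) ?_ ?_ hz
  · refine hmain.trans ?_
    have h1 : 2 * (B₀ * D ^ N / μ) = D ^ N * (2 * (B₀ / μ)) := by ring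
    rw [h1, pow_succ]
    gcongr
    · exact le_max_left _ _
    · exact le_max_right _ _
  · intro w hw
    refine (norm_sub_le _ _).trans (add_le_add ?_ (hTM w hw))
    exact (hball w (hrr w hw)).2.2.1.le
  · intro w hw
    have hwq : ‖w / q‖ ≤ ‖w‖ := by
      rw [norm_div]
      exact div_le_self (norm_nonneg _) hq.le
    obtain ⟨g1, g2, -, g4⟩ := hball (w / q) (hrr _ (hwq.trans hw))
    have hqw : q * (w / q) = w := by field_simp
    rw [hqw] at g4
    have hE := Polynomial.norm_eval_le_of_X_pow_dvd hEX hE1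
      ((hwq.trans hw).trans (min_le_right _ _))
    have hEe' := hEe (w / q)
    rw [hqw] at hEe'
    have hid : P.eval (w / q) * (f w - T.eval w) =
        c * (w / q) ^ s * (f (w / q) - T.eval (w / q)) + E.eval (w / q) := by
      rw [hEe', mul_sub, mul_sub, g4]
      ring
    have hn := congrArg norm hid
    rw [norm_mul] at hn
    have h2 : μ * ‖f w - T.eval w‖ ≤
        μ / 2 * ‖f (w / q) - T.eval (w / q)‖ + B₀ * D ^ N * ‖w‖ ^ N := by
      calc μ * ‖f w - T.eval w‖ ≤ ‖P.eval (w / q)‖ * ‖f w - T.eval w‖ := by gcongr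
        _ ≤ ‖c * (w / q) ^ s‖ * ‖f (w / q) - T.eval (w / q)‖ + ‖E.eval (w / q)‖ := by
            rw [hn, ← norm_mul]; exact norm_add_le _ _
        _ ≤ _ := by
            gcongr
            refine hE.trans ?_
            gcongr
    have h3 : ‖f w - T.eval w‖ ≤
        (μ / 2 * ‖f (w / q) - T.eval (w / q)‖ + B₀ * D ^ N * ‖w‖ ^ N) / μ := by
      rw [le_div_iff₀ hμ0, mul_comm]; exact h2
    refine h3.trans (le_of_eq ?_)
    field_simp

/-- Since N > n, the polynomial B agrees with A·F up to degree n, so its coefficients are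
convolutions. -/
theorem norm_coeff_le_of_X_pow_dvd {F : PowerSeries ℂ} {C : ℝ} (hC : 1 ≤ C)
    (hFC : ∀ n, ‖F.coeff n‖ ≤ C ^ (n + 1)) {n N : ℕ} (hN : n < N) {A B : ℂ[X]}
    (hB : B.natDegree ≤ n) {Y : ℝ} (hAY : ∀ j, ‖A.coeff j‖ ≤ Y)
    (hX : (PowerSeries.X ^ N : PowerSeries ℂ) ∣ (A : PowerSeries ℂ) * F - B) (j : ℕ) :
    ‖B.coeff j‖ ≤ N * Y * C ^ N := by
  have hY : 0 ≤ Y := (norm_nonneg _).trans (hAY 0)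
  by_cases hj : j ≤ n
  · have h := PowerSeries.X_pow_dvd_iff.1 hX j (by omega)
    rw [map_sub, sub_eq_zero, Polynomial.coeff_coe, PowerSeries.coeff_mul,
      Finset.Nat.sum_antidiagonal_eq_sum_range_succ_mk] at h
    rw [← h]
    refine (norm_sum_le_of_le (n := fun _ => Y * C ^ N) _ fun i hi => ?_).trans ?_
    · rw [norm_mul, Polynomial.coeff_coe]
      have := Finset.mem_range.1 hi
      exact mul_le_mul (hAY i) ((hFC _).trans (pow_le_pow_right₀ hC (by omega)))
        (norm_nonneg _) hY
    · rw [Finset.sum_const, Finset.card_range, nsmul_eq_mul, mul_assoc]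
      gcongr
      omega
  · rw [Polynomial.coeff_eq_zero_of_natDegree_lt (by omega), norm_zero]
    positivity

-- Split A f - B as A(f - T) + (A T - B) with T the truncation of F: the first summand is small by
-- the truncation estimate, the second is a polynomial divisible by X^N and falls under Schwarz's
-- lemma. The constants serve all n, N, A and B at once.
open Filter Topology in
theorem exists_norm_mul_sub_le {q c : ℂ} (hq : 1 < ‖q‖) {s : ℕ} (hs : 1 ≤ s) {P Q : ℂ[X]}
    (hP0 : P.coeff 0 ≠ 0) {F : PowerSeries ℂ} (hF : IsFormalSolution q c s P Q F) {C : ℝ}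
    (hC : 1 ≤ C) (hFC : ∀ n, ‖F.coeff n‖ ≤ C ^ (n + 1)) {f : ℂ → ℂ} (hf : ContinuousAt f 0)
    (heq : ∀ᶠ z in 𝓝 (0 : ℂ), c * z ^ s * f z = P.eval z * f (q * z) + Q.eval z) :
    ∃ r : ℝ, 0 < r ∧ ∃ D : ℝ, 1 ≤ D ∧ ∀ (n N : ℕ) (A B : ℂ[X]) (Y : ℝ), n < N →
      A.natDegree ≤ n → B.natDegree ≤ n → (∀ j, ‖A.coeff j‖ ≤ Y) →
      (PowerSeries.X ^ N : PowerSeries ℂ) ∣ (A : PowerSeries ℂ) * F - B → ∀ z : ℂ, ‖z‖ ≤ r →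
      ‖A.eval z * f z - B.eval z‖ ≤ Y * D ^ (N + 1) * ‖z‖ ^ N := by
  obtain ⟨r, hr, hr1, B₁, hB₁, hT⟩ := norm_sub_eval_trunc_le hq hs hP0 hF hC hFC hf heq
  refine ⟨r, hr, 4 * C + 2 * B₁ + 2, by linarith, fun n N A B Y hnN hA hB hAY hX z hz => ?_⟩
  set D := 4 * C + 2 * B₁ + 2 with hD
  set T := PowerSeries.trunc N F with hTdef
  have hY : 0 ≤ Y := (norm_nonneg _).trans (hAY 0)
  have hEX : Polynomial.X ^ N ∣ A * T - B := by
    rw [← X_pow_dvd_coe_iff]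
    have : ((A * T - B : ℂ[X]) : PowerSeries ℂ) =
        (A : PowerSeries ℂ) * ((T : PowerSeries ℂ) - F) + ((A : PowerSeries ℂ) * F - B) := by
      simp only [Polynomial.coe_sub, Polynomial.coe_mul]
      ring
    rw [this]
    exact dvd_add (Dvd.dvd.mul_left (X_pow_dvd_trunc_sub F N) _) hX
  have h2N : (N : ℝ) ≤ 2 ^ N := by exact_mod_cast Nat.lt_two_pow_self.le
  have hnN' : (n : ℝ) + 1 ≤ N := by exact_mod_cast hnN
  have hA1 : ∀ w : ℂ, ‖w‖ ≤ 1 → ‖A.eval w‖ ≤ 2 ^ N * Y := by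
    intro w hw
    have := Polynomial.norm_eval_le hA hAY le_rfl hw
    rw [one_pow, mul_one] at this
    refine this.trans ?_
    gcongr
    linarith
  have hE1 : ∀ w : ℂ, ‖w‖ = 1 → ‖(A * T - B).eval w‖ ≤ Y * (2 * (4 * C) ^ N) := by
    intro w hw
    rw [Polynomial.eval_sub, Polynomial.eval_mul]
    have t1 := norm_eval_trunc_le hC hFC le_rfl hw.le N
    have t2 := Polynomial.norm_eval_le hB (norm_coeff_le_of_X_pow_dvd hC hFC hnN hB hAY hX)
      le_rfl hw.le
    rw [one_pow, mul_one] at t2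
    calc _ ≤ ‖A.eval w * T.eval w‖ + ‖B.eval w‖ := norm_sub_le _ _
      _ ≤ 2 ^ N * Y * (2 * C * 1) ^ N + 2 ^ N * (2 ^ N * Y * C ^ N) := by
          rw [norm_mul]
          refine add_le_add (mul_le_mul (hA1 w hw.le) t1 (norm_nonneg _) (by positivity))
            (t2.trans ?_)
          gcongr
          linarith
      _ = Y * (2 * (4 * C) ^ N) := by
          rw [show (4 : ℝ) = 2 * 2 by norm_num]
          simp only [mul_pow]
          ring
  have hE := Polynomial.norm_eval_le_of_X_pow_dvd hEX hE1 (hz.trans hr1)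
  rw [Polynomial.eval_sub, Polynomial.eval_mul] at hE
  have hsplit : A.eval z * f z - B.eval z =
      A.eval z * (f z - T.eval z) + (A.eval z * T.eval z - B.eval z) := by ring
  rw [hsplit]
  have e1 : (4 * C) ^ N ≤ D ^ N := by
    gcongr
    linarith
  have e2 : (2 * B₁) ^ N ≤ D ^ N := by
    gcongr
    linarith
  calc _ ≤ ‖A.eval z‖ * ‖f z - T.eval z‖ + ‖A.eval z * T.eval z - B.eval z‖ := by
        rw [← norm_mul]; exact norm_add_le _ _
    _ ≤ 2 ^ N * Y * (B₁ ^ (N + 1) * ‖z‖ ^ N) + Y * (2 * (4 * C) ^ N) * ‖z‖ ^ N := by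
        gcongr
        · exact hA1 z (hz.trans hr1)
        · exact hT N z hz
    _ = Y * (B₁ * (2 * B₁) ^ N + 2 * (4 * C) ^ N) * ‖z‖ ^ N := by
        rw [mul_pow, pow_succ]
        ring
    _ ≤ Y * (B₁ * D ^ N + 2 * D ^ N) * ‖z‖ ^ N := by gcongr
    _ ≤ Y * D ^ (N + 1) * ‖z‖ ^ N := by
        gcongr
        rw [pow_succ, ← add_mul, mul_comm]
        gcongr
        linarith

/-! ### Linear algebra of difference modules. -/

theorem Submodule.exists_eq_succ_of_antitone {L V : Type*} [Field L] [AddCommGroup V] [Module L V]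
    [FiniteDimensional L V] {S : ℕ → Submodule L V} (hS : ∀ t, S (t + 1) ≤ S t)
    {n : ℕ} (hn : Module.finrank L V ≤ n) (hSn : S n ≠ ⊥) : ∃ t < n, S t = S (t + 1) := by
  by_contra! h
  have key : ∀ t ≤ n, Module.finrank L (S t) + t ≤ n := by
    intro t
    induction t with
    | zero =>
      intro _
      exact (Submodule.finrank_le _).trans hn
    | succ t ih =>
      intro ht
      have h1 := ih (by omega)
      have h2 := Submodule.finrank_lt_finrank_of_lt (lt_of_le_of_ne (hS t) (h t (by omega)).symm)
      omega
  have := key n le_rfl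
  exact hSn (Submodule.finrank_eq_zero.1 (by omega))

/-- A difference module with one-dimensional, pairwise non-isomorphic graded pieces: a non-zero
submodule of its dual which meets the line of the `0`-th coordinate trivially gives a solution of
one of the inhomogeneous equations of order one. -/
theorem exists_solution_of_stable_submodule {L : Type*} [Field L] (τ : L →+* L) {m : ℕ}
    (p : L) (a b : Fin m → L) (S : Submodule L (Fin (m + 1) → L)) (hS : S ≠ ⊥)
    (h0 : ∀ v ∈ S, (∀ i : Fin m, v i.succ = 0) → v = 0)
    (hstab : ∀ v ∈ S, (Fin.cons (τ (v 0) * p - ∑ i : Fin m, τ (v i.succ) * b i)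
      (fun i : Fin m => τ (v i.succ) * a i) : Fin (m + 1) → L) ∈ S)
    (hne : ∀ i j, i ≠ j → ∀ y : L, y ≠ 0 → τ y * a i ≠ a j * y) :
    ∃ i, ∃ g : L, a i * g = p * τ g + b i := by
  classical
  let supp : (Fin (m + 1) → L) → Finset (Fin m) := fun v => Finset.univ.filter (v ·.succ ≠ 0)
  obtain ⟨v₁, hv₁S, hv₁0⟩ := (Submodule.ne_bot_iff S).1 hS
  -- Shortest relation: minimal support, not counting the 0-th coordinate.
  obtain ⟨v, ⟨hvS, hv0⟩, hmin⟩ := WellFounded.has_min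
    (measure (fun v : Fin (m + 1) → L => (supp v).card)).wf {v | v ∈ S ∧ v ≠ 0} ⟨v₁, hv₁S, hv₁0⟩
  obtain ⟨i₀, hi₀⟩ : ∃ i : Fin m, v i.succ ≠ 0 := by
    by_contra! h
    exact hv0 (h0 v hvS h)
  let u : Fin (m + 1) → L := (v i₀.succ)⁻¹ • v
  have huS : u ∈ S := S.smul_mem _ hvS
  have hu1 : u i₀.succ = 1 := by simp [u, hi₀]
  -- Normalised to u_(i₀) = 1, the image of u minus a_(i₀)·u loses the coordinate i₀, hence vanishes
  -- by minimality. Non-isomorphism then kills the other coordinates, and the 0-th one becomes the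
  -- inhomogeneous equation for -u_0.
  let w : Fin (m + 1) → L := (Fin.cons (τ (u 0) * p - ∑ i : Fin m, τ (u i.succ) * b i)
      (fun i : Fin m => τ (u i.succ) * a i) : Fin (m + 1) → L) - a i₀ • u
  have hwS : w ∈ S := S.sub_mem (hstab u huS) (S.smul_mem _ huS)
  have hws : ∀ i : Fin m, w i.succ = τ (u i.succ) * a i - a i₀ * u i.succ := fun i => by simp [w]
  have hw0 : w = 0 := by
    by_contra hw
    refine hmin w ⟨hwS, hw⟩ (Finset.card_lt_card ?_)
    rw [Finset.ssubset_iff_of_subset]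
    · refine ⟨i₀, by simpa [supp] using hi₀, ?_⟩
      simp [supp, hws, hu1]
    · intro i
      simp only [supp, Finset.mem_filter, Finset.mem_univ, true_and]
      intro h hvi
      apply h
      rw [hws]
      simp [u, hvi]
  have hu0 : ∀ i, i ≠ i₀ → u i.succ = 0 := by
    intro i hi
    by_contra h
    refine hne i i₀ hi _ h ?_
    have := hws i
    rw [hw0] at this
    exact sub_eq_zero.1 this.symm
  refine ⟨i₀, -u 0, ?_⟩
  have hz : w 0 = τ (u 0) * p - (∑ i : Fin m, τ (u i.succ) * b i) - a i₀ * u 0 := by simp [w]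
  rw [Finset.sum_eq_single i₀ (fun i _ hi => by rw [hu0 i hi]; simp) (by simp), hu1, hw0,
    map_one, one_mul] at hz
  rw [map_neg]
  simp only [Pi.zero_apply] at hz
  linear_combination -hz

/-! ### The q-shift on polynomials and rational functions. -/

namespace QDifference

open Polynomial

/-- The automorphism `g(z) ↦ g(q z)` of polynomials. -/
noncomputable def scale (q : ℂ) : ℂ[X] →+* ℂ[X] := compRingHom (C q * X)

theorem scale_apply (q : ℂ) (p : ℂ[X]) : scale q p = p.comp (C q * X) := rfl

theorem coeff_scale (q : ℂ) (p : ℂ[X]) (n : ℕ) : (scale q p).coeff n = p.coeff n * q ^ n := by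
  rw [scale_apply, comp_C_mul_X_coeff]

theorem eval_scale (q z : ℂ) (p : ℂ[X]) : (scale q p).eval z = p.eval (q * z) := by
  rw [scale_apply, eval_comp]
  simp

theorem scale_scale_inv {q : ℂ} (hq : q ≠ 0) (p : ℂ[X]) : scale q (scale q⁻¹ p) = p := by
  ext n
  rw [coeff_scale, coeff_scale, mul_assoc, ← mul_pow, inv_mul_cancel₀ hq, one_pow, mul_one]

theorem scale_injective {q : ℂ} (hq : q ≠ 0) : Function.Injective (scale q) := by
  intro p r h
  ext n
  have := congrArg (fun p => p.coeff n) h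
  simp only [coeff_scale] at this
  exact mul_right_cancel₀ (pow_ne_zero n hq) this

theorem natDegree_scale {q : ℂ} (hq : q ≠ 0) (p : ℂ[X]) : (scale q p).natDegree = p.natDegree := by
  rw [scale_apply, natDegree_comp, natDegree_C_mul_X q hq, mul_one]

theorem leadingCoeff_scale {q : ℂ} (hq : q ≠ 0) (p : ℂ[X]) :
    (scale q p).leadingCoeff = p.leadingCoeff * q ^ p.natDegree := by
  rw [leadingCoeff, natDegree_scale hq, coeff_scale, leadingCoeff]

/-- The automorphism `g(z) ↦ g(q z)` of rational functions. -/
noncomputable def ratScale (q : ℂ) (hq : q ≠ 0) : RatFunc ℂ →+* RatFunc ℂ :=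
  IsFractionRing.lift (A := ℂ[X]) (g := (algebraMap ℂ[X] (RatFunc ℂ)).comp (scale q))
    ((RatFunc.algebraMap_injective ℂ).comp (scale_injective hq))

theorem ratScale_algebraMap {q : ℂ} (hq : q ≠ 0) (p : ℂ[X]) :
    ratScale q hq (algebraMap ℂ[X] (RatFunc ℂ) p) = algebraMap ℂ[X] (RatFunc ℂ) (scale q p) :=
  IsFractionRing.lift_algebraMap _ _

theorem ratScale_div {q : ℂ} (hq : q ≠ 0) (y : RatFunc ℂ) :
    ratScale q hq y = algebraMap ℂ[X] (RatFunc ℂ) (scale q y.num) /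
      algebraMap ℂ[X] (RatFunc ℂ) (scale q y.denom) := by
  conv_lhs => rw [← RatFunc.num_div_denom y]
  rw [map_div₀, ratScale_algebraMap, ratScale_algebraMap]

/-- After clearing denominators, comparison of leading coefficients would give c = c'·q^l with l =
deg(denominator) - deg(numerator). -/
theorem ratScale_mul_ne {q : ℂ} (hq : q ≠ 0) {c c' : ℂ} (hc : ∀ l : ℤ, c ≠ c' * q ^ l) (s : ℕ)
    {y : RatFunc ℂ} (hy : y ≠ 0) :
    ratScale q hq y * algebraMap ℂ[X] (RatFunc ℂ) (C c * X ^ s) ≠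
      algebraMap ℂ[X] (RatFunc ℂ) (C c' * X ^ s) * y := by
  intro h
  have hd := RatFunc.denom_ne_zero y
  have hn := RatFunc.num_ne_zero hy
  have hd' : scale q y.denom ≠ 0 := by
    rw [Ne, map_eq_zero_iff _ (scale_injective hq)]; exact hd
  rw [ratScale_div] at h
  nth_rewrite 3 [← RatFunc.num_div_denom y] at h
  rw [div_mul_eq_mul_div, mul_div_assoc', div_eq_div_iff (RatFunc.algebraMap_ne_zero hd')
    (RatFunc.algebraMap_ne_zero hd)] at h
  simp only [← map_mul] at h
  have h := RatFunc.algebraMap_injective ℂ h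
  have hl := congrArg leadingCoeff h
  simp only [leadingCoeff_mul, leadingCoeff_scale hq, leadingCoeff_C, leadingCoeff_X_pow] at hl
  apply hc ((y.denom.natDegree : ℤ) - y.num.natDegree)
  have h1 := leadingCoeff_ne_zero.2 hn
  have h2 := leadingCoeff_ne_zero.2 hd
  rw [zpow_sub₀ hq, zpow_natCast, zpow_natCast]
  field_simp
  have := mul_ne_zero h1 h2
  apply mul_left_cancel₀ this
  linear_combination hl

/-- Let D be the monic denominator of g in lowest terms. It does not vanish at 0, and the equation
makes it divide its own q-shift; equality of degrees and the value at 0 then force D = 1. -/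
theorem exists_polynomial_eq_of_ratFunc_solution {q c : ℂ} (hq : 1 < ‖q‖) (hq0 : q ≠ 0) (hc : c ≠ 0)
    {s : ℕ} (hs : 1 ≤ s) {P Q : ℂ[X]} (hP : P.eval 0 ≠ 0) {g : RatFunc ℂ}
    (hg : algebraMap ℂ[X] (RatFunc ℂ) (C c * X ^ s) * g =
      algebraMap ℂ[X] (RatFunc ℂ) P * ratScale q hq0 g + algebraMap ℂ[X] (RatFunc ℂ) Q) :
    ∃ p : ℂ[X], C c * X ^ s * p = P * scale q p + Q := by
  have hd := RatFunc.denom_ne_zero g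
  have hmonic := RatFunc.monic_denom g
  have hcop := RatFunc.isCoprime_num_denom g
  have hd' : scale q g.denom ≠ 0 := by
    rw [Ne, map_eq_zero_iff _ (scale_injective hq0)]; exact hd
  have hgnd := RatFunc.num_div_denom g
  have hr := ratScale_div hq0 g
  set N := g.num
  set D := g.denom
  have heq : C c * X ^ s * N * scale q D = P * scale q N * D + Q * D * scale q D := by
    rw [hr, ← hgnd] at hg
    have e1 := RatFunc.algebraMap_ne_zero hd
    have e2 := RatFunc.algebraMap_ne_zero hd'
    apply RatFunc.algebraMap_injective ℂ
    simp only [map_mul, map_add] at hg ⊢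
    field_simp at hg
    linear_combination hg
  have hN0 : N.eval 0 = 0 → D.eval 0 ≠ 0 := by
    intro h1 h2
    obtain ⟨x, y, hxy⟩ := hcop
    have := congrArg (eval 0) hxy
    simp [h1, h2] at this
  -- A pole of order k at 0 would persist with order exactly k in P(z)g(qz), while z^s g(z) has a
  -- pole of smaller order because s ≥ 1.
  have hD0 : D.eval 0 ≠ 0 := by
    intro hD0
    obtain ⟨E, hE, hXE⟩ := exists_eq_pow_rootMultiplicity_mul_and_not_dvd D hd 0
    set k := D.rootMultiplicity 0
    have hk : 1 ≤ k := (rootMultiplicity_pos hd).2 hD0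
    rw [C_0, sub_zero] at hE hXE
    have hsD : scale q D = X ^ k * (C q ^ k * scale q E) := by
      rw [hE, map_mul, map_pow, show scale q X = C q * X by simp [scale_apply], mul_pow]
      ring
    obtain ⟨k', rfl⟩ : ∃ k', s = k' + 1 := ⟨s - 1, by omega⟩
    obtain ⟨j, hj⟩ : ∃ j, k = j + 1 := ⟨k - 1, by omega⟩
    have hXk : (X : ℂ[X]) ^ k ≠ 0 := pow_ne_zero _ X_ne_zero
    have hdvd : (X : ℂ[X]) ∣ P * scale q N * E := by
      refine ⟨C c * X ^ k' * N * (C q ^ k * scale q E) - Q * (X ^ j * E) *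
        (C q ^ k * scale q E), ?_⟩
      apply mul_left_cancel₀ hXk
      have h3 : X ^ k * (P * scale q N * E) = C c * X ^ (k' + 1) * N * scale q D -
          Q * D * scale q D := by
        rw [show X ^ k * (P * scale q N * E) = P * scale q N * (X ^ k * E) by ring, ← hE]
        linear_combination -heq
      rw [h3, hsD, hE]
      have : (X : ℂ[X]) ^ k = X ^ j * X := by rw [hj, pow_succ]
      rw [this]
      ring
    rcases prime_X.dvd_or_dvd hdvd with h | h
    · rcases prime_X.dvd_or_dvd h with h | h
      · rw [X_dvd_iff, coeff_zero_eq_eval_zero] at h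
        exact hP h
      · rw [X_dvd_iff, coeff_zero_eq_eval_zero, eval_scale, mul_zero] at h
        exact hN0 h hD0
    · exact hXE h
  have hdvd : D ∣ scale q D := by
    have h1 : D ∣ N * (C c * X ^ s * scale q D) := by
      refine ⟨P * scale q N + Q * scale q D, ?_⟩
      linear_combination heq
    have h2 := hcop.symm.dvd_of_dvd_mul_left h1
    have h3 : IsCoprime D X := by
      rw [isCoprime_comm]
      refine (irreducible_X.coprime_iff_not_dvd).2 ?_
      rw [X_dvd_iff, coeff_zero_eq_eval_zero]
      exact hD0
    have h4 := IsCoprime.pow_right (n := s) h3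
    rw [mul_assoc] at h2
    have h5 : D ∣ X ^ s * scale q D :=
      (IsUnit.dvd_mul_left (isUnit_C.2 hc.isUnit)).1 h2
    exact h4.dvd_of_dvd_mul_left h5
  -- Hence D(qz) = q^(deg D)·D(z); at z = 0 this gives q^(deg D) = 1, impossible for |q| > 1 unless
  -- deg D = 0.
  have h6 := eq_leadingCoeff_mul_of_monic_of_dvd_of_natDegree_le hmonic hdvd
    (natDegree_scale hq0 D).le
  have h7 := congrArg (eval 0) h6
  rw [eval_scale, mul_zero, eval_mul, eval_C, leadingCoeff_scale hq0, hmonic.leadingCoeff,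
    one_mul] at h7
  have h8 : q ^ D.natDegree = 1 := by
    apply mul_right_cancel₀ hD0
    rw [one_mul]
    exact h7.symm
  have h9 : D.natDegree = 0 := by
    by_contra h
    have := one_lt_pow₀ hq h
    rw [← norm_pow, h8, norm_one] at this
    exact lt_irrefl _ this
  have h10 : D = 1 := hmonic.natDegree_eq_zero.1 h9
  refine ⟨N, ?_⟩
  rw [h10, map_one] at heq
  linear_combination heq

end QDifference

/-! ### Iterated approximations and their determinant. -/

namespace QDifference

open Polynomial

/-- `∏_{j=1}^k P(z / q ^ j) * A(z / q ^ k)`, the denominators of the approximations obtained from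
`A`, `B` by iterating the functional equation. -/
noncomputable def denomIter (q : ℂ) (P A : ℂ[X]) : ℕ → ℂ[X]
  | 0 => A
  | k + 1 => scale q⁻¹ (P * denomIter q P A k)

/-- The numerators of the approximations obtained from `A`, `B` by iterating the functional
equation `c z ^ s f(z) = P(z) f(q z) + Q(z)`. -/
noncomputable def numerIter (q c : ℂ) (s : ℕ) (P Q A B : ℂ[X]) : ℕ → ℂ[X]
  | 0 => B
  | k + 1 => scale q⁻¹ (C c * X ^ s * numerIter q c s P Q A B k - Q * denomIter q P A k)

/-- The vector of the denominator and of the numerators after `k` iterations. -/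
noncomputable def approxRow (q : ℂ) {m : ℕ} (c : Fin m → ℂ) (s : ℕ) (P : ℂ[X]) (Q : Fin m → ℂ[X])
    (A : ℂ[X]) (B : Fin m → ℂ[X]) (k : ℕ) : Fin (m + 1) → ℂ[X] :=
  Fin.cons (denomIter q P A k) fun i => numerIter q (c i) s P (Q i) A (B i) k

/-- The determinant of the first `m + 1` approximations. -/
noncomputable def approxDet (q : ℂ) {m : ℕ} (c : Fin m → ℂ) (s : ℕ) (P : ℂ[X]) (Q : Fin m → ℂ[X])
    (A : ℂ[X]) (B : Fin m → ℂ[X]) : ℂ[X] :=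
  (Matrix.of fun j i : Fin (m + 1) => approxRow q c s P Q A B j i).det

section

variable {q : ℂ} {m : ℕ} {c : Fin m → ℂ} {s : ℕ} {P : ℂ[X]} {Q : Fin m → ℂ[X]} {A : ℂ[X]}
  {B : Fin m → ℂ[X]}

theorem eval_denomIter_succ (k : ℕ) (z : ℂ) :
    (denomIter q P A (k + 1)).eval z = P.eval (z / q) * (denomIter q P A k).eval (z / q) := by
  rw [denomIter, eval_scale, eval_mul, div_eq_inv_mul]

theorem eval_numerIter_succ {c : ℂ} {Q B : ℂ[X]} (k : ℕ) (z : ℂ) :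
    (numerIter q c s P Q A B (k + 1)).eval z =
      c * (z / q) ^ s * (numerIter q c s P Q A B k).eval (z / q) -
        Q.eval (z / q) * (denomIter q P A k).eval (z / q) := by
  rw [numerIter, eval_scale, div_eq_inv_mul]
  simp

/-- If the determinant vanished, the spaces S t of vectors over ℂ(z) annihilating the first t rows
would be nonzero up to t = m+1. As they decrease, two consecutive ones coincide, and this common
space is stable under the dual difference operator, so `exists_solution_of_stable_submodule`
applies. -/
theorem approxDet_ne_zero (hq : 1 < ‖q‖) (hc : ∀ i, c i ≠ 0)
    (hcq : ∀ i j, i ≠ j → ∀ l : ℤ, c i ≠ c j * q ^ l) (hs : 1 ≤ s) (hP : P.eval 0 ≠ 0)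
    (hsol : ∀ i, ¬ ∃ p : ℂ[X], C (c i) * X ^ s * p = P * scale q p + Q i) (hA : A ≠ 0) :
    approxDet q c s P Q A B ≠ 0 := by
  intro hdet
  have hq0 : q ≠ 0 := by
    rintro rfl
    simp at hq
    linarith
  let ι := algebraMap ℂ[X] (RatFunc ℂ)
  let τ := ratScale q hq0
  let r := approxRow q c s P Q A B
  let S : ℕ → Submodule (RatFunc ℂ) (Fin (m + 1) → RatFunc ℂ) := fun t =>
    { carrier := {v | ∀ j < t, ∑ i, v i * ι (r j i) = 0}
      add_mem' := by
        intro v w hv hw j hj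
        simp only [Pi.add_apply, add_mul, Finset.sum_add_distrib, hv j hj, hw j hj, add_zero]
      zero_mem' := by
        intro j _
        simp
      smul_mem' := by
        intro a v hv j hj
        simp only [Pi.smul_apply, smul_eq_mul, mul_assoc, ← Finset.mul_sum, hv j hj, mul_zero] }
  have hmem : ∀ t v, v ∈ S t ↔ ∀ j < t, ∑ i, v i * ι (r j i) = 0 := fun t v => Iff.rfl
  have hSbot : S (m + 1) ≠ ⊥ := by
    have h1 : (ι.mapMatrix (Matrix.of fun j i : Fin (m + 1) => r j i)).det = 0 := by
      rw [← RingHom.map_det]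
      change ι (approxDet q c s P Q A B) = 0
      rw [hdet, map_zero]
    obtain ⟨v, hv0, hv⟩ := Matrix.exists_mulVec_eq_zero_iff.2 h1
    rw [Submodule.ne_bot_iff]
    refine ⟨v, fun j hj => ?_, hv0⟩
    have := congrFun hv ⟨j, hj⟩
    simp only [Matrix.mulVec, dotProduct, RingHom.mapMatrix_apply, Matrix.map_apply,
      Matrix.of_apply, Pi.zero_apply] at this
    rw [← this]
    exact Finset.sum_congr rfl fun i _ => mul_comm _ _
  obtain ⟨t, htm, ht⟩ := Submodule.exists_eq_succ_of_antitone (S := S)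
    (fun t v hv j hj => hv j (by omega)) (n := m + 1) (by simp) hSbot
  have hSt : S (t + 1) ≠ ⊥ := by
    intro h
    rw [eq_bot_iff] at h
    exact hSbot (eq_bot_iff.2 fun v hv => h fun j hj => hv j (by omega))
  suffices h : ∃ i, ∃ g : RatFunc ℂ, ι (C (c i) * X ^ s) * g = ι P * τ g + ι (Q i) by
    obtain ⟨i, g, hg⟩ := h
    exact hsol i (exists_polynomial_eq_of_ratFunc_solution hq hq0 (hc i) hs hP hg)
  refine exists_solution_of_stable_submodule τ (ι P)
    (fun i => ι (C (c i) * X ^ s)) (fun i => ι (Q i)) (S (t + 1)) hSt ?_ ?_ ?_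
  -- Row 0 begins with A ≠ 0, so no nonzero multiple of the 0-th basis vector annihilates it.
  · intro v hv h
    have h1 := hv 0 (by omega)
    rw [Fin.sum_univ_succ] at h1
    simp only [h, zero_mul, Finset.sum_const_zero, add_zero, mul_eq_zero] at h1
    have h2 : ι (r 0 0) ≠ 0 := RatFunc.algebraMap_ne_zero hA
    funext i
    exact Fin.cases (h1.resolve_right h2) h i
  -- Applying τ to the relation with row j+1 yields a relation of the transformed vector with row j,
  -- so S (t+1) is mapped into S t, which equals S (t+1).
  · intro v hv
    rw [← ht]
    intro j hj
    have h1 := congrArg τ (hv (j + 1) (by omega))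
    rw [map_sum, map_zero, Fin.sum_univ_succ] at h1
    have e0 : τ (ι (r (j + 1) 0)) = ι (P * denomIter q P A j) := by
      simp only [r, τ, ι, approxRow, Fin.cons_zero]
      rw [ratScale_algebraMap, denomIter, scale_scale_inv hq0]
    have e1 : ∀ i : Fin m, τ (ι (r (j + 1) i.succ)) =
        ι (C (c i) * X ^ s * numerIter q (c i) s P (Q i) A (B i) j - Q i * denomIter q P A j) := by
      intro i
      simp only [r, τ, ι, approxRow, Fin.cons_succ]
      rw [ratScale_algebraMap, numerIter, scale_scale_inv hq0]
    simp only [map_mul τ, e0, e1] at h1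
    rw [← h1, Fin.sum_univ_succ]
    simp only [r, approxRow, Fin.cons_zero, Fin.cons_succ]
    rw [sub_mul, Finset.sum_mul, sub_add, ← Finset.sum_sub_distrib, sub_eq_add_neg,
      ← Finset.sum_neg_distrib, mul_assoc, map_mul]
    congr 1
    refine Finset.sum_congr rfl fun i _ => ?_
    rw [map_sub, map_mul ι (_ * _) (numerIter _ _ _ _ _ _ _ _), map_mul ι (Q i)]
    ring
  · intro i j hij y hy
    exact ratScale_mul_ne hq0 (hcq i j hij) s hy

/-- One iteration replaces the remainder R(z) by c(z/q)^s R(z/q), so the order at 0 does not drop.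
-/
theorem X_pow_dvd_iter {c : ℂ} {Q B : ℂ[X]} (hq0 : q ≠ 0) {F : PowerSeries ℂ}
    (hF : IsFormalSolution q c s P Q F) {N : ℕ}
    (h : (PowerSeries.X ^ N : PowerSeries ℂ) ∣ (A : PowerSeries ℂ) * F - (B : PowerSeries ℂ)) (k : ℕ) :
    (PowerSeries.X ^ N : PowerSeries ℂ) ∣
      (denomIter q P A k : PowerSeries ℂ) * F - (numerIter q c s P Q A B k : PowerSeries ℂ) := by
  induction k with
  | zero => exact h
  | succ k ih =>
    have hF' := congrArg (PowerSeries.rescale q⁻¹) hF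
    rw [map_add, map_mul, map_mul _ (P : PowerSeries ℂ), PowerSeries.rescale_rescale,
      mul_inv_cancel₀ hq0, PowerSeries.rescale_one, RingHom.id_apply] at hF'
    have : (denomIter q P A (k + 1) : PowerSeries ℂ) * F -
        (numerIter q c s P Q A B (k + 1) : PowerSeries ℂ) =
        PowerSeries.rescale q⁻¹ (PowerSeries.C c * PowerSeries.X ^ s *
          ((denomIter q P A k : PowerSeries ℂ) * F - (numerIter q c s P Q A B k : PowerSeries ℂ))) := by
      rw [denomIter, numerIter, scale_apply, scale_apply, coe_comp_C_mul_X, coe_comp_C_mul_X]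
      simp only [Polynomial.coe_sub, Polynomial.coe_mul, Polynomial.coe_C,
        Polynomial.coe_pow, Polynomial.coe_X, map_sub, map_mul] at hF' ⊢
      linear_combination -(PowerSeries.rescale q⁻¹ (denomIter q P A k : PowerSeries ℂ)) * hF'
    rw [this]
    exact X_pow_dvd_rescale _ (Dvd.dvd.mul_left ih _)

theorem natDegree_denomIter_le (hq0 : q ≠ 0) (hP : P.natDegree ≤ s) {n : ℕ} (hA : A.natDegree ≤ n)
    (k : ℕ) : (denomIter q P A k).natDegree ≤ n + k * s := by
  induction k with
  | zero => simpa [denomIter] using hA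
  | succ k ih =>
    rw [denomIter, natDegree_scale (inv_ne_zero hq0)]
    refine natDegree_mul_le.trans ?_
    rw [add_mul]
    omega

theorem natDegree_numerIter_le {c : ℂ} {Q B : ℂ[X]} (hq0 : q ≠ 0) (hP : P.natDegree ≤ s) {n t : ℕ}
    (hQ : Q.natDegree ≤ t) (hA : A.natDegree ≤ n) (hB : B.natDegree ≤ n) (k : ℕ) :
    (numerIter q c s P Q A B k).natDegree ≤ n + k * s + t := by
  induction k with
  | zero =>
    have : B.natDegree ≤ n + 0 * s + t := by omega
    simpa [numerIter] using this
  | succ k ih =>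
    rw [numerIter, natDegree_scale (inv_ne_zero hq0)]
    refine (natDegree_sub_le _ _).trans (max_le ?_ ?_)
    · refine natDegree_mul_le.trans ?_
      have := natDegree_C_mul_X_pow_le c s
      rw [add_mul]
      omega
    · refine natDegree_mul_le.trans ?_
      have := natDegree_denomIter_le (q := q) hq0 hP hA k
      rw [add_mul]
      omega

theorem natDegree_approxDet_le (hq0 : q ≠ 0) (hP : P.natDegree ≤ s) {n t : ℕ}
    (hQ : ∀ i, (Q i).natDegree ≤ t) (hA : A.natDegree ≤ n) (hB : ∀ i, (B i).natDegree ≤ n) :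
    (approxDet q c s P Q A B).natDegree ≤ (m + 1) * (n + m * s + t) := by
  have hentry : ∀ j i : Fin (m + 1),
      (approxRow q c s P Q A B j i).natDegree ≤ n + m * s + t := by
    intro j i
    have hj : (j : ℕ) * s ≤ m * s := by
      gcongr
      omega
    refine Fin.cases ?_ (fun i => ?_) i
    · have := natDegree_denomIter_le (q := q) hq0 hP hA j
      simp only [approxRow, Fin.cons_zero]
      omega
    · have := natDegree_numerIter_le (q := q) (c := c i) hq0 hP (hQ i) hA (hB i) j
      simp only [approxRow, Fin.cons_succ]
      omega
  rw [approxDet, Matrix.det_apply]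
  refine natDegree_sum_le_of_forall_le _ _ fun σ _ => ?_
  refine (natDegree_smul_le _ _).trans ((natDegree_prod_le _ _).trans ?_)
  refine (Finset.sum_le_card_nsmul _ _ (n + m * s + t) fun i _ => ?_).trans
    (le_of_eq ?_)
  · exact hentry _ _
  · simp

theorem X_pow_dvd_approxDet (hq0 : q ≠ 0) {F : Fin m → PowerSeries ℂ}
    (hF : ∀ i, IsFormalSolution q (c i) s P (Q i) (F i)) {N : Fin m → ℕ}
    (h : ∀ i, (PowerSeries.X ^ N i : PowerSeries ℂ) ∣ (A : PowerSeries ℂ) * F i - B i) :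
    X ^ (∑ i, N i) ∣ approxDet q c s P Q A B := by
  rw [← X_pow_dvd_coe_iff]
  let V : Matrix (Fin (m + 1)) (Fin (m + 1)) (PowerSeries ℂ) :=
    Matrix.of fun j i => (approxRow q c s P Q A B j i : PowerSeries ℂ)
  have hV : ((approxDet q c s P Q A B : ℂ[X]) : PowerSeries ℂ) = V.det := by
    let φ : ℂ[X] →+* PowerSeries ℂ := Polynomial.coeToPowerSeries.ringHom
    exact φ.map_det _
  -- Column operations: right multiplication by this triangular matrix, with diagonal 1, -1, …, -1,
  -- replaces the numerator columns by the remainders.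
  let T : Matrix (Fin (m + 1)) (Fin (m + 1)) (PowerSeries ℂ) :=
    Matrix.of fun k i => Fin.cases (if k = 0 then 1 else 0)
      (fun i => if k = 0 then F i else if k = i.succ then -1 else 0) i
  have hT0 : ∀ k, T k 0 = if k = 0 then 1 else 0 := fun k => rfl
  have hTs : ∀ k (i : Fin m), T k i.succ = if k = 0 then F i else if k = i.succ then -1 else 0 :=
    fun k i => rfl
  have hT : IsUnit T.det := by
    have htri : T.BlockTriangular id := by
      intro k i hki
      have hk : k ≠ 0 := by
        rintro rfl
        exact absurd hki (Fin.not_lt_zero _)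
      revert hki
      refine Fin.cases ?_ (fun i => ?_) i
      · intro _
        rw [hT0, if_neg hk]
      · intro hki
        rw [hTs, if_neg hk, if_neg]
        exact (ne_of_lt hki).symm
    rw [Matrix.det_of_isUpperTriangular htri]
    rw [IsUnit.prod_univ_iff]
    intro k
    refine Fin.cases ?_ (fun i => ?_) k
    · rw [hT0]; simp
    · rw [hTs, if_neg (Fin.succ_ne_zero i), if_pos rfl]
      exact isUnit_one.neg
  rw [hV, ← hT.dvd_mul_right, ← Matrix.det_mul, Matrix.det_apply]
  refine Finset.dvd_sum fun σ _ => ?_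
  rw [Units.smul_def, zsmul_eq_mul]
  refine Dvd.dvd.mul_left ?_ _
  rw [Fin.prod_univ_succ, ← Finset.prod_pow_eq_pow_sum]
  refine Dvd.dvd.mul_left (Finset.prod_dvd_prod_of_dvd _ _ fun i _ => ?_) _
  have : (V * T) (σ i.succ) i.succ = (denomIter q P A (σ i.succ) : PowerSeries ℂ) * F i -
      (numerIter q (c i) s P (Q i) A (B i) (σ i.succ) : ℂ[X]) := by
    rw [Matrix.mul_apply, Fin.sum_univ_succ]
    simp only [hTs, if_true, Fin.succ_ne_zero, if_false, Fin.succ_inj, mul_ite, mul_zero,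
      Finset.sum_ite_eq', Finset.mem_univ]
    simp only [V, Matrix.of_apply, approxRow, Fin.cons_zero, Fin.cons_succ]
    ring
  rw [this]
  exact X_pow_dvd_iter hq0 (hF i) (h i) _

/-- The functional equation turns a vector annihilating rows k, …, k+m at z into one annihilating
rows k-1, …, k-1+m at z/q. The transfer is triangular with diagonal P(z/q), c_i(z/q)^s, all nonzero,
so the vector stays nonzero. After k transfers the rows of the determinant itself are reached. -/
theorem eval_approxDet_eq_zero (hq0 : q ≠ 0) (hc : ∀ i, c i ≠ 0) (k : ℕ) :
    ∀ (z : ℂ) (l : Fin (m + 1) → ℂ), z ≠ 0 → (∀ i : ℕ, 1 ≤ i → P.eval (z / q ^ i) ≠ 0) → l ≠ 0 →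
      (∀ j ≤ m, ∑ i, l i * (approxRow q c s P Q A B (k + j) i).eval z = 0) →
      (approxDet q c s P Q A B).eval (z / q ^ k) = 0 := by
  induction k with
  | zero =>
    intro z l _ _ hl h
    rw [pow_zero, div_one, approxDet, ← coe_evalRingHom, RingHom.map_det]
    rw [← Matrix.exists_mulVec_eq_zero_iff]
    refine ⟨l, hl, ?_⟩
    funext j
    have := h j (by omega)
    rw [zero_add] at this
    rw [Pi.zero_apply, ← this]
    simp only [Matrix.mulVec, dotProduct, RingHom.mapMatrix_apply, Matrix.map_apply,
      Matrix.of_apply, coe_evalRingHom]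
    exact Finset.sum_congr rfl fun i _ => mul_comm _ _
  | succ k ih =>
    intro z l hz hP hl h
    have hzq : z / q ≠ 0 := div_ne_zero hz hq0
    have hPz : P.eval (z / q) ≠ 0 := by simpa using hP 1 le_rfl
    have := ih (z / q) (Fin.cons (l 0 * P.eval (z / q) - ∑ i : Fin m, l i.succ * (Q i).eval (z / q))
      (fun i : Fin m => l i.succ * (c i * (z / q) ^ s))) hzq ?_ ?_ ?_
    · rw [div_div, ← pow_succ'] at this
      exact this
    · intro i hi
      rw [div_div, ← pow_succ']
      exact hP (i + 1) (by omega)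
    · intro h0
      apply hl
      have hs : ∀ i : Fin m, l i.succ = 0 := by
        intro i
        have := congrFun h0 i.succ
        simp only [Fin.cons_succ, Pi.zero_apply, mul_eq_zero, hc i, pow_eq_zero_iff', hzq,
          false_and, or_false] at this
        exact this
      funext i
      refine Fin.cases ?_ hs i
      have := congrFun h0 0
      simpa [hs, hPz] using this
    · intro j hj
      rw [← h j hj, Fin.sum_univ_succ, Fin.sum_univ_succ, show k + 1 + j = k + j + 1 by ring]
      simp only [approxRow, Fin.cons_zero, Fin.cons_succ, eval_denomIter_succ, eval_numerIter_succ]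
      rw [sub_mul, Finset.sum_mul, sub_add, ← Finset.sum_sub_distrib, sub_eq_add_neg,
        ← Finset.sum_neg_distrib, mul_assoc]
      congr 1
      refine Finset.sum_congr rfl fun i _ => ?_
      ring

end

end QDifference

/-! ### Zero estimate, integrality of the values, and construction of the approximations. -/

namespace QDifference

open Polynomial

section

variable {q : ℂ} {m : ℕ} {c : Fin m → ℂ} {s : ℕ} {P : ℂ[X]} {Q : Fin m → ℂ[X]} {A : ℂ[X]}
  {B : Fin m → ℂ[X]}

/-- If all w+m consecutive forms vanished, the determinant would have w distinct zeros z/q^k besides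
its zero of order at least ΣN_i at 0, exceeding its degree. -/
theorem exists_sum_approxRow_ne_zero (hq : 1 < ‖q‖) (hc : ∀ i, c i ≠ 0)
    (hPs : P.natDegree ≤ s) {n t : ℕ} (hQt : ∀ i, (Q i).natDegree ≤ t)
    (hAn : A.natDegree ≤ n) (hBn : ∀ i, (B i).natDegree ≤ n) {F : Fin m → PowerSeries ℂ}
    (hF : ∀ i, IsFormalSolution q (c i) s P (Q i) (F i)) {N : Fin m → ℕ}
    (hX : ∀ i, (PowerSeries.X ^ N i : PowerSeries ℂ) ∣ (A : PowerSeries ℂ) * F i - B i)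
    (hdet : approxDet q c s P Q A B ≠ 0)
    {z : ℂ} (hz : z ≠ 0) (hPz : ∀ i : ℕ, 1 ≤ i → P.eval (z / q ^ i) ≠ 0)
    {l : Fin (m + 1) → ℂ} (hl : l ≠ 0) (k₀ w : ℕ)
    (hw : (m + 1) * (n + m * s + t) < ∑ i, N i + w) :
    ∃ k, k₀ ≤ k ∧ k < k₀ + w + m ∧ ∑ i, l i * (approxRow q c s P Q A B k i).eval z ≠ 0 := by
  have hq0 : q ≠ 0 := by
    rintro rfl
    simp at hq
    linarith
  by_contra! h
  obtain ⟨G, hG⟩ := X_pow_dvd_approxDet hq0 hF hX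
  have hG0 : G ≠ 0 := by
    rintro rfl
    exact hdet (by rw [hG, mul_zero])
  have hdeg := natDegree_approxDet_le (c := c) hq0 hPs hQt hAn hBn
  rw [hG, natDegree_mul (pow_ne_zero _ X_ne_zero) hG0, natDegree_X_pow] at hdeg
  refine hG0 (eq_zero_of_natDegree_lt_card_of_eval_eq_zero G
    (f := fun k : Fin w => z / q ^ (k₀ + k : ℕ)) ?_ ?_ ?_)
  · intro k k' hkk
    have h1 : ‖z‖ / ‖q‖ ^ (k₀ + k : ℕ) = ‖z‖ / ‖q‖ ^ (k₀ + k' : ℕ) := by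
      have := congrArg norm hkk
      simpa using this
    have h2 : ‖q‖ ^ (k₀ + k : ℕ) = ‖q‖ ^ (k₀ + k' : ℕ) := by
      have hzn : ‖z‖ ≠ 0 := norm_ne_zero_iff.2 hz
      have hqn : ‖q‖ ≠ 0 := norm_ne_zero_iff.2 hq0
      field_simp at h1
      exact h1.symm
    have := pow_right_injective₀ (by linarith) hq.ne' h2
    exact Fin.ext (by omega)
  · intro k
    have h1 := eval_approxDet_eq_zero (B := B) (A := A) (Q := Q) hq0 hc (k₀ + k) z l hz hPz hl
      fun j hj => h (k₀ + k + j) (by omega) (by omega)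
    rw [hG, eval_mul, eval_pow, eval_X] at h1
    exact (mul_eq_zero.1 h1).resolve_left
      (pow_ne_zero _ (div_ne_zero hz (pow_ne_zero _ hq0)))
  · rw [Fintype.card_fin]
    omega

end

theorem triangular_succ (k : ℕ) : (k + 1) * (k + 1 + 1) / 2 = k * (k + 1) / 2 + (k + 1) := by
  rw [show (k + 1) * (k + 1 + 1) = k * (k + 1) + (k + 1) * 2 by ring]
  exact Nat.add_mul_div_right _ _ (by norm_num)

theorem triangular_mono {j k : ℕ} (h : j ≤ k) : j * (j + 1) / 2 ≤ k * (k + 1) / 2 := by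
  gcongr

theorem triangular_cast (k : ℕ) : ((k * (k + 1) / 2 : ℕ) : ℝ) = k * (k + 1) / 2 := by
  rw [Nat.cast_div (Nat.even_mul_succ_self k).two_dvd (by norm_num)]
  push_cast
  ring

variable {q c : ℂ} {s : ℕ} {P Q A B : ℂ[X]}

/-- The remainder picks up c(z/q^i)^s at the i-th step, whence the triangular power of q. The
equation is needed only along the orbit z/q^i. -/
theorem denomIter_mul_sub_numerIter (hq0 : q ≠ 0) {f : ℂ → ℂ} (k : ℕ) :
    ∀ z : ℂ, (∀ i : ℕ, 1 ≤ i → c * (z / q ^ i) ^ s * f (z / q ^ i) =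
      P.eval (z / q ^ i) * f (q * (z / q ^ i)) + Q.eval (z / q ^ i)) →
    (denomIter q P A k).eval z * f z - (numerIter q c s P Q A B k).eval z =
      c ^ k * (z ^ k / q ^ (k * (k + 1) / 2)) ^ s *
        (A.eval (z / q ^ k) * f (z / q ^ k) - B.eval (z / q ^ k)) := by
  induction k with
  | zero => intro z _; simp [denomIter, numerIter]
  | succ k ih =>
    intro z hz
    have h1 := hz 1 le_rfl
    rw [pow_one, mul_div_cancel₀ z hq0] at h1
    have h2 := ih (z / q) fun i hi => by
      rw [div_div, ← pow_succ']
      exact hz (i + 1) (by omega)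
    rw [eval_denomIter_succ, eval_numerIter_succ]
    have h3 : P.eval (z / q) * (denomIter q P A k).eval (z / q) * f z -
        (c * (z / q) ^ s * (numerIter q c s P Q A B k).eval (z / q) -
          Q.eval (z / q) * (denomIter q P A k).eval (z / q)) =
        c * (z / q) ^ s * ((denomIter q P A k).eval (z / q) * f (z / q) -
          (numerIter q c s P Q A B k).eval (z / q)) := by
      linear_combination -(denomIter q P A k).eval (z / q) * h1
    rw [h3, h2, div_div z q, ← pow_succ', triangular_succ]
    have h4 : (z ^ (k + 1) / q ^ (k * (k + 1) / 2 + (k + 1))) =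
        (z / q) * ((z / q) ^ k / q ^ (k * (k + 1) / 2)) := by
      rw [pow_add, div_pow]
      field_simp
      ring
    rw [h4, mul_pow]
    ring

theorem norm_eval_denomIter_le (hq : 1 < ‖q‖) {M ρ : ℝ} (hM0 : 0 ≤ M)
    (hM : ∀ w : ℂ, ‖w‖ ≤ ρ → ‖P.eval w‖ ≤ M) (k : ℕ) :
    ∀ z : ℂ, ‖z‖ ≤ ρ → ‖(denomIter q P A k).eval z‖ ≤ M ^ k * ‖A.eval (z / q ^ k)‖ := by
  induction k with
  | zero => intro z _; simp [denomIter]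
  | succ k ih =>
    intro z hz
    have hzq : ‖z / q‖ ≤ ρ := by
      rw [norm_div]
      exact (div_le_self (norm_nonneg _) hq.le).trans hz
    have h2 := ih (z / q) hzq
    rw [div_div, ← pow_succ'] at h2
    rw [eval_denomIter_succ, norm_mul, pow_succ', mul_assoc]
    exact mul_le_mul (hM _ hzq) h2 (norm_nonneg _) hM0

theorem eval_mem {R : Subring ℂ} {p : ℂ[X]} {g y x : ℂ} (hy : y ∈ R) (hyx : y * x ∈ R)
    (hp : ∀ i, g * p.coeff i ∈ R) {e : ℕ} (he : p.natDegree ≤ e) : g * y ^ e * p.eval x ∈ R := by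
  rw [eval_eq_sum_range' (Nat.lt_succ_of_le he), Finset.mul_sum]
  refine Subring.sum_mem _ fun i hi => ?_
  have hi : i ≤ e := Nat.lt_succ_iff.1 (Finset.mem_range.1 hi)
  have : g * y ^ e * (p.coeff i * x ^ i) = g * p.coeff i * (y * x) ^ i * y ^ (e - i) := by
    rw [mul_pow, show y ^ e = y ^ i * y ^ (e - i) by rw [← pow_add]; congr 1; omega]
    ring
  rw [this]
  exact Subring.mul_mem _ (Subring.mul_mem _ (hp i) (Subring.pow_mem _ hyx _))
    (Subring.pow_mem _ hy _)

section Integrality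

variable {R : Subring ℂ} {a b α d G : ℂ}

theorem mul_pow_mul_div_mem (hb : b ∈ R) (hqab : b * q = a) (hq0 : q ≠ 0) (hα : d * α ∈ R)
    (j : ℕ) : d * a ^ j * (α / q ^ j) ∈ R := by
  have : d * a ^ j * (α / q ^ j) = d * α * b ^ j := by
    rw [← hqab, mul_pow]
    field_simp
  rw [this]
  exact Subring.mul_mem _ hα (Subring.pow_mem _ hb _)

/-- P is evaluated at α/q^(j+1), …, α/q^(j+k), costing a to the power s(jk + k(k+1)/2), and A at
α/q^(j+k). The point α/q^j is general because the induction moves it; only j = 0 is needed in the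
end. -/
theorem eval_denomIter_mem (ha : a ∈ R) (hb : b ∈ R) (hd : d ∈ R) (hqab : b * q = a)
    (hq0 : q ≠ 0) (hα : d * α ∈ R) (hPs : P.natDegree ≤ s) (hP : ∀ i, d * P.coeff i ∈ R) {n : ℕ}
    (hAn : A.natDegree ≤ n) (hA : ∀ i, A.coeff i ∈ R) (k : ℕ) : ∀ j : ℕ,
    (d ^ (s + 1)) ^ k * a ^ (s * (j * k + k * (k + 1) / 2)) * (d * a ^ (j + k)) ^ n *
      (denomIter q P A k).eval (α / q ^ j) ∈ R := by
  induction k with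
  | zero =>
    intro j
    have := eval_mem (g := 1) (Subring.mul_mem _ hd (Subring.pow_mem _ ha j))
      (mul_pow_mul_div_mem hb hqab hq0 hα j) (by simpa using hA) hAn
    simpa [denomIter] using this
  | succ k ih =>
    intro j
    have h1 := eval_mem (Subring.mul_mem _ hd (Subring.pow_mem _ ha (j + 1)))
      (mul_pow_mul_div_mem hb hqab hq0 hα (j + 1)) hP hPs
    have h2 := ih (j + 1)
    rw [eval_denomIter_succ, div_div, ← pow_succ]
    convert Subring.mul_mem _ h1 h2 using 1
    rw [triangular_succ, show j * (k + 1) + (k * (k + 1) / 2 + (k + 1)) =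
      (j + 1) + ((j + 1) * k + k * (k + 1) / 2) by ring, show j + (k + 1) = j + 1 + k by ring]
    generalize k * (k + 1) / 2 = T
    rw [mul_add s, pow_add a, mul_pow d (a ^ (j + 1)) s, ← pow_mul a (j + 1) s]
    ring

/-- Here G is a denominator for the coefficients of B; the degree t of Q accounts for the exponent
n+t in place of n. -/
theorem eval_numerIter_mem (ha : a ∈ R) (hb : b ∈ R) (hd : d ∈ R) (hG : G ∈ R) (hqab : b * q = a)
    (hq0 : q ≠ 0) (hα : d * α ∈ R) (hc : d * c ∈ R) (hPs : P.natDegree ≤ s)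
    (hP : ∀ i, d * P.coeff i ∈ R) {n t : ℕ} (hQt : Q.natDegree ≤ t)
    (hQ : ∀ i, d * Q.coeff i ∈ R) (hAn : A.natDegree ≤ n) (hA : ∀ i, A.coeff i ∈ R)
    (hBn : B.natDegree ≤ n) (hB : ∀ i, G * B.coeff i ∈ R) (k : ℕ) : ∀ j : ℕ,
    G * d * (d ^ (s + 1)) ^ k * a ^ (s * (j * k + k * (k + 1) / 2)) * (d * a ^ (j + k)) ^ (n + t) *
      (numerIter q c s P Q A B k).eval (α / q ^ j) ∈ R := by
  induction k with
  | zero =>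
    intro j
    have h0 := Subring.mul_mem _ hd (Subring.pow_mem _ ha j)
    have h1 := eval_mem h0 (mul_pow_mul_div_mem hb hqab hq0 hα j) hB hBn
    convert Subring.mul_mem _ (Subring.mul_mem _ hd (Subring.pow_mem _ h0 t)) h1 using 1
    simp only [numerIter, pow_zero, mul_zero, zero_mul, Nat.zero_div, add_zero]
    rw [pow_add]
    ring
  | succ k ih =>
    intro j
    have h0 := mul_pow_mul_div_mem hb hqab hq0 hα (j + 1)
    have h1 := eval_mem (Subring.mul_mem _ hd (Subring.pow_mem _ ha (j + 1))) h0 hQ hQt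
    have h2 := eval_denomIter_mem ha hb hd hqab hq0 hα hPs hP hAn hA k (j + 1)
    have h3 := Subring.mul_mem _ (Subring.mul_mem _ hc (Subring.pow_mem _ h0 s)) (ih (j + 1))
    have h4 := Subring.mul_mem _ (Subring.mul_mem _ (Subring.mul_mem _ hG h1) h2)
      (Subring.mul_mem _ (Subring.mul_mem _ (Subring.pow_mem _ hd (s + 1))
        (Subring.pow_mem _ ha (s * (j + 1)))) (Subring.pow_mem _ ha (k * t)))
    rw [eval_numerIter_succ, div_div, ← pow_succ]
    convert Subring.sub_mem _ h3 h4 using 1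
    rw [triangular_succ, show j * (k + 1) + (k * (k + 1) / 2 + (k + 1)) =
      (j + 1) + ((j + 1) * k + k * (k + 1) / 2) by ring, show j + (k + 1) = j + 1 + k by ring]
    generalize k * (k + 1) / 2 = T
    generalize α / q ^ (j + 1) = x
    rw [mul_add s, pow_add a]
    ring

end Integrality

/-- Siegel's lemma yields simultaneous approximations `B i / A` to the power series `F i`. -/
theorem exists_approximation {R : Subring ℂ} {a d : ℂ} {c₀ C : ℝ} (hc₀ : 1 ≤ c₀)
    (hR1 : ∀ x ∈ R, x ≠ 0 → 1 ≤ ‖x‖)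
    (hR : ∀ (ι κ : Type) [Fintype ι] [Fintype κ] (a : ι → κ → ℂ) (A : ℝ),
      1 ≤ A → (∀ i j, a i j ∈ R) → (∀ i j, ‖a i j‖ ≤ A) → 0 < Fintype.card ι →
      Fintype.card ι < Fintype.card κ →
      ∃ x : κ → ℂ, x ≠ 0 ∧ (∀ j, x j ∈ R) ∧ (∀ i, ∑ j, a i j * x j = 0) ∧
        ∀ j, ‖x j‖ ≤ c₀ * (c₀ * Fintype.card κ * A) ^
          ((Fintype.card ι : ℝ) / (Fintype.card κ - Fintype.card ι)))
    (ha : a ∈ R) (ha0 : a ≠ 0) (hd : d ∈ R) (hd0 : d ≠ 0) {m : ℕ} {F : Fin m → PowerSeries ℂ}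
    (hC : 1 ≤ C) (hFC : ∀ i n, ‖(F i).coeff n‖ ≤ C ^ (n + 1))
    (hFR : ∀ i n, d ^ (n + 1) * a ^ (n * (n + 1) / 2) * (F i).coeff n ∈ R)
    {n M : ℕ} {ν : Fin m → ℕ} (hM : M = ∑ i, ν i) (hM0 : 0 < M) (hMn : M ≤ n) :
    ∃ (A : ℂ[X]) (B : Fin m → ℂ[X]), A ≠ 0 ∧ A.natDegree ≤ n ∧ (∀ j, A.coeff j ∈ R) ∧
      (∀ j, ‖A.coeff j‖ ≤ c₀ * (c₀ * (n + 1) * (‖d‖ ^ (n + M + 1) *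
        ‖a‖ ^ ((n + M) * (n + M + 1) / 2) * C ^ (n + M + 1))) ^ ((M : ℝ) / (n + 1 - M))) ∧
      (∀ i, (B i).natDegree ≤ n) ∧
      (∀ i j, d ^ (n + 1) * a ^ (n * (n + 1) / 2) * (B i).coeff j ∈ R) ∧
      ∀ i, (PowerSeries.X ^ (n + ν i + 1) : PowerSeries ℂ) ∣ (A : PowerSeries ℂ) * F i - B i := by
  have hd1 := hR1 d hd hd0
  have ha1 := hR1 a ha ha0
  have hmul : ∀ i k l, k ≤ l → d ^ (l + 1) * a ^ (l * (l + 1) / 2) * (F i).coeff k ∈ R := by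
    intro i k l hkl
    obtain ⟨e, he⟩ := Nat.exists_eq_add_of_le (triangular_mono hkl)
    obtain ⟨e', rfl⟩ := Nat.exists_eq_add_of_le hkl
    have : d ^ (k + e' + 1) * a ^ ((k + e') * (k + e' + 1) / 2) * (F i).coeff k =
        d ^ e' * a ^ e * (d ^ (k + 1) * a ^ (k * (k + 1) / 2) * (F i).coeff k) := by
      rw [he]
      ring
    rw [this]
    exact Subring.mul_mem _ (Subring.mul_mem _ (Subring.pow_mem _ hd _)
      (Subring.pow_mem _ ha _)) (hFR i k)
  have hνM : ∀ i, ν i ≤ M := fun i => hM ▸ Finset.single_le_sum (fun _ _ => Nat.zero_le _)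
    (Finset.mem_univ i)
  have hbound : ∀ (p : Σ i : Fin m, Fin (ν i)) (j : Fin (n + 1)),
      ‖d ^ (n + 1 + p.2 + 1) * a ^ ((n + 1 + p.2) * (n + 1 + p.2 + 1) / 2) *
        (F p.1).coeff (n + 1 + p.2 - j)‖ ≤
      ‖d‖ ^ (n + M + 1) * ‖a‖ ^ ((n + M) * (n + M + 1) / 2) * C ^ (n + M + 1) := by
    intro p j
    have hp := hνM p.1
    have hp2 := p.2.2
    rw [norm_mul, norm_mul, norm_pow, norm_pow]
    have e : n + 1 + (p.2 : ℕ) ≤ n + M := by omega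
    refine mul_le_mul (mul_le_mul (pow_le_pow_right₀ hd1 (by omega))
      (pow_le_pow_right₀ ha1 (triangular_mono e)) (by positivity) (by positivity))
      ((hFC _ _).trans (pow_le_pow_right₀ hC (by omega))) (by positivity) (by positivity)
  -- The unknowns are the n+1 coefficients of A; the M equations say that the coefficients of
  -- z^(n+1), …, z^(n+ν_i) in A·F_i vanish, each multiplied by its own denominator.
  obtain ⟨x, hx0, hxR, hx, hxb⟩ := hR (Σ i : Fin m, Fin (ν i)) (Fin (n + 1))
    (fun p j => d ^ (n + 1 + p.2 + 1) * a ^ ((n + 1 + p.2) * (n + 1 + p.2 + 1) / 2) *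
      (F p.1).coeff (n + 1 + p.2 - j))
    (‖d‖ ^ (n + M + 1) * ‖a‖ ^ ((n + M) * (n + M + 1) / 2) * C ^ (n + M + 1))
    (one_le_mul_of_one_le_of_one_le (one_le_mul_of_one_le_of_one_le (one_le_pow₀ hd1)
      (one_le_pow₀ ha1)) (one_le_pow₀ hC))
    (fun p j => hmul _ _ _ (Nat.sub_le _ _)) hbound (by simpa [← hM] using hM0)
    (by simp [← hM]; omega)
  have hcoe : ∀ j (hj : j < n + 1), (ofFn (n + 1) x).coeff j = x ⟨j, hj⟩ := fun j hj =>
    ofFn_coeff_eq_val_of_lt x hj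
  have hcoe0 : ∀ j, n + 1 ≤ j → (ofFn (n + 1) x).coeff j = 0 := fun j hj =>
    ofFn_coeff_eq_zero_of_ge x hj
  have hAR : ∀ j, (ofFn (n + 1) x).coeff j ∈ R := by
    intro j
    rcases lt_or_ge j (n + 1) with h | h
    · rw [hcoe j h]; exact hxR _
    · rw [hcoe0 j h]; exact Subring.zero_mem _
  refine ⟨ofFn (n + 1) x, fun i => PowerSeries.trunc (n + 1) ((ofFn (n + 1) x : PowerSeries ℂ) * F i),
    ?_, ?_, hAR, ?_, ?_, ?_, ?_⟩
  · intro h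
    apply hx0
    funext j
    rw [← hcoe j j.2, h]
    simp
  · exact Nat.lt_succ_iff.1 (ofFn_natDegree_lt (by omega) x)
  · intro j
    have hb := hxb 0
    rcases lt_or_ge j (n + 1) with h | h
    · rw [hcoe j h]
      have := hxb ⟨j, h⟩
      simpa [← hM] using this
    · rw [hcoe0 j h, norm_zero]
      positivity
  · intro i
    exact Nat.lt_succ_iff.1 (PowerSeries.natDegree_trunc_lt _ n)
  · intro i j
    rw [PowerSeries.coeff_trunc]
    split_ifs with h
    · rw [PowerSeries.coeff_mul, Finset.mul_sum]
      refine Subring.sum_mem _ fun p hp => ?_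
      have hp := Finset.HasAntidiagonal.mem_antidiagonal.1 hp
      rw [coeff_coe, mul_left_comm]
      exact Subring.mul_mem _ (hAR _) (hmul _ _ _ (by omega))
    · rw [mul_zero]
      exact Subring.zero_mem _
  · intro i
    rw [PowerSeries.X_pow_dvd_iff]
    intro k hk
    rw [map_sub, coeff_coe, PowerSeries.coeff_trunc]
    split_ifs with h
    · rw [sub_self]
    · rw [sub_zero, PowerSeries.coeff_mul, Finset.Nat.sum_antidiagonal_eq_sum_range_succ_mk]
      have h1 := hx ⟨i, ⟨k - (n + 1), by omega⟩⟩
      simp only [show n + 1 + (k - (n + 1)) = k by omega] at h1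
      have h2 : d ^ (k + 1) * a ^ (k * (k + 1) / 2) ≠ 0 :=
        mul_ne_zero (pow_ne_zero _ hd0) (pow_ne_zero _ ha0)
      apply mul_left_cancel₀ h2
      rw [mul_zero, ← h1, ← Finset.sum_subset (Finset.range_subset_range.2 (by omega : n + 1 ≤ k + 1)),
        Finset.sum_range, Finset.mul_sum]
      · refine Finset.sum_congr rfl fun j _ => ?_
        rw [coeff_coe, hcoe j j.2]
        ring
      · intro j _ hj
        rw [coeff_coe, hcoe0 j (by simpa using hj), zero_mul]

-- The difference of f and p solves the homogeneous equation, vanishes near 0 by the truncation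
-- estimate, and then vanishes off Z by climbing along w/q^k. This converts non-polynomiality of f
-- into the absence of polynomial solutions.
open Filter Topology in
theorem eq_eval_of_polynomial_solution (hq : 1 < ‖q‖) (hs : 1 ≤ s) (hP : P.eval 0 ≠ 0) {f : ℂ → ℂ}
    {Z : Set ℂ} (hf : ContinuousAt f 0) (hZ : Zᶜ ∈ 𝓝 (0 : ℂ))
    (hZq : ∀ z ∉ Z, z / q ∉ Z ∧ P.eval (z / q) ≠ 0)
    (heq : ∀ z, q * z ∉ Z → c * z ^ s * f z = P.eval z * f (q * z) + Q.eval z)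
    {p : ℂ[X]} (hp : C c * X ^ s * p = P * scale q p + Q) {z : ℂ} (hz : z ∉ Z) :
    f z = p.eval z := by
  have hq0 : q ≠ 0 := by
    rintro rfl
    simp at hq
    linarith
  have hpe : ∀ w, c * w ^ s * p.eval w = P.eval w * p.eval (q * w) + Q.eval w := by
    intro w
    have := congrArg (eval w) hp
    simpa [eval_scale] using this
  let h : ℂ → ℂ := fun w => f w - p.eval w
  have hh : ∀ w, q * w ∉ Z → c * w ^ s * h w = P.eval w * h (q * w) := by
    intro w hw
    simp only [h]
    linear_combination heq w hw - hpe w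
  have hev : ∀ᶠ w in 𝓝 (0 : ℂ), c * w ^ s * h w = P.eval w * h (q * w) + eval w 0 := by
    have h2 : Tendsto (fun w : ℂ => q * w) (𝓝 0) (𝓝 0) := by
      have : Continuous fun w : ℂ => q * w := by fun_prop
      simpa using this.tendsto 0
    filter_upwards [h2.eventually hZ] with w hw
    rw [eval_zero, add_zero]
    exact hh w hw
  have hP' : P.coeff 0 ≠ 0 := by rwa [coeff_zero_eq_eval_zero]
  -- The zero series solves the homogeneous equation, so near 0 the bound D(D|w|)^N holds for every
  -- N.
  obtain ⟨r, hr, -, D, hD, hb⟩ := norm_sub_eval_trunc_le (F := 0) (C := 1) hq hs hP'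
    (by simp [IsFormalSolution]) le_rfl (by simp) (hf.sub p.continuous.continuousAt) hev
  have hsmall : ∀ w : ℂ, ‖w‖ ≤ r → ‖w‖ < 1 / D → h w = 0 := by
    intro w hw hwD
    have h1 : ∀ N : ℕ, ‖h w‖ ≤ D * (D * ‖w‖) ^ N := by
      intro N
      have := hb N w hw
      simp only [map_zero, eval_zero, sub_zero] at this
      refine this.trans (le_of_eq ?_)
      rw [mul_pow]
      ring
    have h2 : D * ‖w‖ < 1 := by
      rw [lt_div_iff₀ (by linarith)] at hwD
      linarith
    have h3 : Tendsto (fun N : ℕ => D * (D * ‖w‖) ^ N) atTop (𝓝 (D * 0)) :=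
      (tendsto_pow_atTop_nhds_zero_of_lt_one (by positivity) h2).const_mul D
    rw [mul_zero] at h3
    exact norm_le_zero_iff.1 (ge_of_tendsto' h3 h1)
  have hclimb : ∀ k : ℕ, ∀ w ∉ Z, h (w / q ^ k) = 0 → h w = 0 := by
    intro k
    induction k with
    | zero => intro w _ hw; simpa using hw
    | succ k ih =>
      intro w hwZ hw
      have h1 := hZq w hwZ
      have h2 := ih (w / q) h1.1 (by rw [div_div, ← pow_succ']; exact hw)
      have h3 := hh (w / q) (by rwa [mul_div_cancel₀ w hq0])
      rw [h2, mul_zero, mul_div_cancel₀ w hq0] at h3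
      exact (mul_eq_zero.1 h3.symm).resolve_left h1.2
  have hlim : Tendsto (fun k : ℕ => ‖z / q ^ k‖) atTop (𝓝 0) := by
    have h1 : Tendsto (fun k : ℕ => ‖z‖ * (‖q‖⁻¹) ^ k) atTop (𝓝 (‖z‖ * 0)) :=
      (tendsto_pow_atTop_nhds_zero_of_lt_one (by positivity)
        (inv_lt_one_of_one_lt₀ hq)).const_mul _
    rw [mul_zero] at h1
    refine h1.congr fun k => ?_
    rw [norm_div, norm_pow, inv_pow, div_eq_mul_inv]
  obtain ⟨k, hk1, hk2⟩ := ((hlim.eventually_le_const hr).and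
    (hlim.eventually_lt_const (by positivity : 0 < 1 / D))).exists
  exact sub_eq_zero.1 (hclimb k z hz (hsmall _ hk1 hk2))

end QDifference

/-! ### Bookkeeping of exponents. -/

namespace QDifference

open Polynomial

/-- Origin of γ₁: the Siegel exponent is at most (1-δ)/δ, and n+M ≤ (2-δ)n makes the triangular
exponent of |a| at most (2-δ)²n²/2 + n. Everything else is linear in n. -/
theorem siegel_bound_le_exp {lam K δ c₀ u v C : ℝ} (hlam : 0 ≤ lam) (hK : 0 ≤ K) (hδ : 0 < δ)
    (hδ1 : δ < 1) (hc₀ : 1 ≤ c₀) (hu : 1 ≤ u) (hC : 1 ≤ C) (hc₀K : c₀ ≤ Real.exp K)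
    (huK : u ≤ Real.exp K) (hCK : C ≤ Real.exp K) (hv : v = Real.exp lam) {n M : ℕ} (hn : 1 ≤ n)
    (hM : (M : ℝ) ≤ (1 - δ) * n) :
    c₀ * (c₀ * (n + 1) * (u ^ (n + M + 1) * v ^ ((n + M) * (n + M + 1) / 2) * C ^ (n + M + 1))) ^
      ((M : ℝ) / (n + 1 - M)) ≤
    Real.exp (lam * ((2 - δ) ^ 2 * (1 - δ) / (2 * δ)) * n ^ 2 +
      (K + (1 - δ) / δ * (7 * K + 1 + lam)) * n) := by
  have hn' : (1 : ℝ) ≤ n := by exact_mod_cast hn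
  have hM0 : (0 : ℝ) ≤ M := by positivity
  have hMn : (M : ℝ) ≤ n := hM.trans (by nlinarith)
  have hv1 : 1 ≤ v := by rw [hv]; exact Real.one_le_exp hlam
  set E := K + n + (n + M + 1) * K + (n + M) * (n + M + 1) / 2 * lam + (n + M + 1) * K with hE
  have hbase : c₀ * (n + 1) * (u ^ (n + M + 1) * v ^ ((n + M) * (n + M + 1) / 2) *
      C ^ (n + M + 1)) ≤ Real.exp E := by
    have h1 : u ^ (n + M + 1) ≤ Real.exp ((n + M + 1) * K) := by
      calc u ^ (n + M + 1) ≤ Real.exp K ^ (n + M + 1) := by gcongr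
        _ = _ := by rw [← Real.exp_nat_mul]; push_cast; rfl
    have h2 : C ^ (n + M + 1) ≤ Real.exp ((n + M + 1) * K) := by
      calc C ^ (n + M + 1) ≤ Real.exp K ^ (n + M + 1) := by gcongr
        _ = _ := by rw [← Real.exp_nat_mul]; push_cast; rfl
    have h3 : v ^ ((n + M) * (n + M + 1) / 2) = Real.exp ((n + M) * (n + M + 1) / 2 * lam) := by
      rw [hv, ← Real.exp_nat_mul, triangular_cast]
      push_cast
      rfl
    have h4 : (n : ℝ) + 1 ≤ Real.exp n := Real.add_one_le_exp _
    rw [h3]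
    calc _ ≤ Real.exp K * Real.exp n * (Real.exp ((n + M + 1) * K) *
          Real.exp ((n + M) * (n + M + 1) / 2 * lam) * Real.exp ((n + M + 1) * K)) := by gcongr
      _ = Real.exp E := by
          rw [hE]
          simp only [← Real.exp_add]
          congr 1
          ring
  have hden : 0 < (n : ℝ) + 1 - M := by linarith
  have hr0 : 0 ≤ (M : ℝ) / (n + 1 - M) := by positivity
  have hr : (M : ℝ) / (n + 1 - M) ≤ (1 - δ) / δ := by
    rw [div_le_div_iff₀ hden hδ]
    nlinarith
  have hE0 : 0 ≤ E := by positivity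
  have hEle : E ≤ lam * (2 - δ) ^ 2 / 2 * n ^ 2 + (7 * K + 1 + lam) * n := by
    have hS : (n : ℝ) + M ≤ (2 - δ) * n := by linarith
    have hS0 : (0 : ℝ) ≤ (n : ℝ) + M := by positivity
    have h1 : ((n : ℝ) + M) * (n + M + 1) / 2 ≤ (2 - δ) ^ 2 / 2 * n ^ 2 + n := by
      have : ((n : ℝ) + M) * (n + M) ≤ ((2 - δ) * n) * ((2 - δ) * n) :=
        mul_le_mul hS hS hS0 (hS0.trans hS)
      nlinarith
    have h2 := mul_le_mul_of_nonneg_right h1 hlam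
    have h3 : ((n : ℝ) + M + 1) * K ≤ 3 * n * K := by
      gcongr
      linarith
    have h4 : K ≤ n * K := le_mul_of_one_le_left hK hn'
    rw [hE]
    linarith
  have hbase0 : 0 ≤ c₀ * (n + 1) * (u ^ (n + M + 1) * v ^ ((n + M) * (n + M + 1) / 2) *
      C ^ (n + M + 1)) := by positivity
  calc _ ≤ Real.exp K * (Real.exp E) ^ ((M : ℝ) / (n + 1 - M)) := by gcongr
    _ = Real.exp (K + E * ((M : ℝ) / (n + 1 - M))) := by
        rw [← Real.exp_mul, ← Real.exp_add]
    _ ≤ _ := by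
        rw [Real.exp_le_exp]
        have h1 : E * ((M : ℝ) / (n + 1 - M)) ≤
            (lam * (2 - δ) ^ 2 / 2 * n ^ 2 + (7 * K + 1 + lam) * n) * ((1 - δ) / δ) := by gcongr
        have h2 : K ≤ K * n := le_mul_of_one_le_right hK hn'
        have h3 : (lam * (2 - δ) ^ 2 / 2 * n ^ 2 + (7 * K + 1 + lam) * n) * ((1 - δ) / δ) =
            lam * ((2 - δ) ^ 2 * (1 - δ) / (2 * δ)) * n ^ 2 +
              (1 - δ) / δ * (7 * K + 1 + lam) * n := by
          field_simp
        linarith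

theorem quadratic_bound {θ w n k : ℝ} (hθ : 0 ≤ θ) (hw : 0 ≤ w) (hn : 1 ≤ n) (hk0 : 0 ≤ k)
    (hk : k ≤ θ * n + w) :
    k ≤ (θ + w) * n ∧ k * (k + 1) / 2 ≤ θ ^ 2 / 2 * n ^ 2 + (θ + w) ^ 2 * n + (θ + w) * n := by
  have hT : k ≤ (θ + w) * n := by nlinarith
  refine ⟨hT, ?_⟩
  have h1 : k * k ≤ (θ * n + w) * (θ * n + w) := by gcongr
  have h2 : w * w ≤ w * w * n := le_mul_of_one_le_right (by positivity) hn
  have h3 : 0 ≤ θ ^ 2 * n := by positivity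
  nlinarith

/-- The logarithm of the size of the denominators. -/
theorem exists_denominator_exponent (lam K κ₁ γ₁ θ w : ℝ) (s t : ℕ) (hlam : 0 ≤ lam) (hK : 0 ≤ K)
    (hθ : 0 ≤ θ) (hw : 0 ≤ w) :
    ∃ κ : ℝ, ∀ n k : ℝ, 1 ≤ n → 0 ≤ k → k ≤ θ * n + w →
      (2 * n + 2 + t + (s + 1) * k) * K +
        (n * (n + 1) / 2 + s * (k * (k + 1) / 2) + k * (n + t)) * lam +
        (k * K + (n + (lam * γ₁ * n ^ 2 + κ₁ * n) + n * K)) ≤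
      lam * (γ₁ + θ + 1 / 2 * (1 + s * θ ^ 2)) * n ^ 2 + κ * n := by
  refine ⟨(4 + t + (s + 1) * (θ + w)) * K + (1 / 2 + s * ((θ + w) ^ 2 + (θ + w)) + w +
    (θ + w) * t) * lam + ((θ + w) * K + 1 + κ₁ + K), fun n k hn hk0 hk => ?_⟩
  obtain ⟨h1, h2⟩ := quadratic_bound hθ hw hn hk0 hk
  have e1 : (2 * n + 2 + t + (s + 1) * k) * K ≤ ((4 + t + (s + 1) * (θ + w)) * n) * K := by
    gcongr
    have : (s + 1) * k ≤ (s + 1) * ((θ + w) * n) := by gcongr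
    have : (t : ℝ) ≤ t * n := le_mul_of_one_le_right (by positivity) hn
    linarith
  have e2 : (s : ℝ) * (k * (k + 1) / 2) ≤
      s * (θ ^ 2 / 2 * n ^ 2 + (θ + w) ^ 2 * n + (θ + w) * n) := by gcongr
  have e3 : k * (n + t) ≤ θ * n ^ 2 + w * n + (θ + w) * n * t := by
    have : k * n ≤ (θ * n + w) * n := by gcongr
    have : k * t ≤ (θ + w) * n * t := by gcongr
    linarith
  -- The quadratic terms: 1/2 from the denominators of the series, sθ²/2 from the values of P, and θ
  -- from evaluating polynomials of degree n at α/q^k.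
  have e4 : (n * (n + 1) / 2 + s * (k * (k + 1) / 2) + k * (n + t)) * lam ≤
      ((θ + 1 / 2 * (1 + s * θ ^ 2)) * n ^ 2 + (1 / 2 + s * ((θ + w) ^ 2 + (θ + w)) + w +
        (θ + w) * t) * n) * lam := by
    refine mul_le_mul_of_nonneg_right ?_ hlam
    linarith
  have e5 : k * K ≤ (θ + w) * n * K := by gcongr
  linarith

/-- The logarithm of the size of the remainders. -/
theorem exists_remainder_exponent (lam K κ₁ γ₁ γ ρ θ w : ℝ) (s t : ℕ) (hlam : 0 ≤ lam) (hK : 0 ≤ K)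
    (hγ : 0 ≤ γ) (hγ1 : γ ≤ 1) (hθ : 0 ≤ θ) (hw : 0 ≤ w) :
    ∃ κ : ℝ, ∀ n k ν : ℝ, 1 ≤ n → 0 ≤ k → k ≤ θ * n + w → ρ * n ≤ k → 0 ≤ ν → ν ≤ n →
      (2 * n + 2 + t + (s + 1) * k) * K +
        (n * (n + 1) / 2 + s * (k * (k + 1) / 2) + k * (n + t)) * lam +
        (k * K + s * (k * K - k * (k + 1) / 2 * ((1 - γ) * lam)) +
          ((lam * γ₁ * n ^ 2 + κ₁ * n) + (n + ν + 2) * K +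
            (n + ν + 1) * (K - k * ((1 - γ) * lam)))) ≤
      lam * ((γ₁ + 1 / 2 + γ * s * θ ^ 2 / 2 + γ * θ) * n ^ 2 + (γ * θ - ρ) * n * ν) + κ * n := by
  refine ⟨(4 + t + (s + 1) * (θ + w)) * K + (θ + w) * K + s * ((θ + w) * K) + κ₁ + 7 * K +
    (1 / 2 + γ * s * ((θ + w) ^ 2 + (θ + w)) + 2 * γ * w + (θ + w) * t) * lam,
    fun n k ν hn hk0 hk hρk hν0 hνn => ?_⟩
  obtain ⟨h1, h2⟩ := quadratic_bound hθ hw hn hk0 hk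
  have e1 : (2 * n + 2 + t + (s + 1) * k) * K ≤ ((4 + t + (s + 1) * (θ + w)) * n) * K := by
    gcongr
    have : (s + 1) * k ≤ (s + 1) * ((θ + w) * n) := by gcongr
    have : (t : ℝ) ≤ t * n := le_mul_of_one_le_right (by positivity) hn
    linarith
  have e2 : γ * s * (k * (k + 1) / 2) ≤
      γ * s * (θ ^ 2 / 2 * n ^ 2 + (θ + w) ^ 2 * n + (θ + w) * n) := by gcongr
  have e3 : γ * (k * (n + ν)) ≤ γ * ((θ * n + w) * (n + ν)) := by gcongr
  have e4 : k * t ≤ (θ + w) * n * t := by gcongr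
  have e5 : k * K ≤ (θ + w) * n * K := by gcongr
  have e6 : s * (k * K) ≤ s * ((θ + w) * n * K) := by gcongr
  have e7 : (2 * (n + ν) + 3) * K ≤ (7 * n) * K := by
    gcongr
    linarith
  have e8 : ρ * n * ν ≤ k * ν := by gcongr
  have e9 : 0 ≤ (1 - γ) * k := mul_nonneg (by linarith) hk0
  have e10 : γ * w * ν ≤ γ * w * n := by gcongr
  -- The denominators cost powers of |a|, while smallness gains the same powers of |q| = |a|^(1-γ),
  -- so only a fraction γ of the cost survives. The upper bound on k controls the terms in γ; the
  -- lower bound k ≥ ρn is what makes -kν at most -ρnν.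
  have e11 : (n * (n + 1) / 2 + γ * s * (k * (k + 1) / 2) + γ * (k * (n + ν)) - k * ν + k * t -
      (1 - γ) * k) * lam ≤
      ((1 / 2 + γ * s * θ ^ 2 / 2 + γ * θ) * n ^ 2 + (γ * θ - ρ) * n * ν +
        (1 / 2 + γ * s * ((θ + w) ^ 2 + (θ + w)) + 2 * γ * w + (θ + w) * t) * n) * lam := by
    refine mul_le_mul_of_nonneg_right ?_ hlam
    linarith
  linarith

end QDifference

/-! ### Small integral forms with prescribed weights. -/

namespace QDifference

open Polynomial

/-- Solutions `f i`, with Taylor series `F i`, of `c i * z ^ s * f(z) = P(z) f(q z) + Q i (z)`, none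
of which is a polynomial, together with a point `α` and a common denominator `d` for all data. -/
structure IsSystem (R : Subring ℂ) (a b q d α : ℂ) {m : ℕ} (c : Fin m → ℂ) (s t : ℕ) (P : ℂ[X])
    (Q : Fin m → ℂ[X]) (F : Fin m → PowerSeries ℂ) (f : Fin m → ℂ → ℂ) : Prop where
  a_mem : a ∈ R
  b_mem : b ∈ R
  d_mem : d ∈ R
  b_ne_zero : b ≠ 0
  d_ne_zero : d ≠ 0
  b_mul_q : b * q = a
  one_lt_norm_q : 1 < ‖q‖
  c_ne_zero : ∀ i, c i ≠ 0
  c_ne_mul_zpow : ∀ i j, i ≠ j → ∀ l : ℤ, c i ≠ c j * q ^ l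
  one_le_s : 1 ≤ s
  natDegree_P : P.natDegree ≤ s
  P_eval_zero : P.eval 0 ≠ 0
  natDegree_Q : ∀ i, (Q i).natDegree ≤ t
  not_polynomial : ∀ i, ¬ ∃ p : ℂ[X], C (c i) * X ^ s * p = P * scale q p + Q i
  α_ne_zero : α ≠ 0
  P_eval_ne_zero : ∀ k : ℕ, 1 ≤ k → P.eval (α / q ^ k) ≠ 0
  d_mul_α : d * α ∈ R
  d_mul_c : ∀ i, d * c i ∈ R
  d_mul_P : ∀ j, d * P.coeff j ∈ R
  d_mul_Q : ∀ i j, d * (Q i).coeff j ∈ R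
  coeff_mem : ∀ i n, d ^ (n + 1) * a ^ (n * (n + 1) / 2) * (F i).coeff n ∈ R
  formal : ∀ i, IsFormalSolution q (c i) s P (Q i) (F i)
  norm_coeff : ∃ C : ℝ, 1 ≤ C ∧ ∀ i n, ‖(F i).coeff n‖ ≤ C ^ (n + 1)
  remainder : ∃ r : ℝ, 0 < r ∧ ∃ D : ℝ, 1 ≤ D ∧ ∀ (i : Fin m) (n N : ℕ) (A B : ℂ[X]) (Y : ℝ),
    n < N → A.natDegree ≤ n → B.natDegree ≤ n → (∀ j, ‖A.coeff j‖ ≤ Y) →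
    (PowerSeries.X ^ N : PowerSeries ℂ) ∣ (A : PowerSeries ℂ) * F i - B → ∀ z : ℂ, ‖z‖ ≤ r →
    ‖A.eval z * f i z - B.eval z‖ ≤ Y * D ^ (N + 1) * ‖z‖ ^ N
  equation : ∀ i, ∀ k : ℕ, 1 ≤ k → c i * (α / q ^ k) ^ s * f i (α / q ^ k) =
    P.eval (α / q ^ k) * f i (q * (α / q ^ k)) + (Q i).eval (α / q ^ k)

theorem pow_le_exp {x K : ℝ} (hx : 0 ≤ x) (h : x ≤ Real.exp K) (n : ℕ) :
    x ^ n ≤ Real.exp (n * K) := by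
  rw [Real.exp_nat_mul]
  gcongr

/-- Integral linear forms which are simultaneously small in all `f i (α)`, with a choice of weights
`ν i`, and which do not annihilate a given vector. -/
theorem IsSystem.exists_integral_forms {R : Subring ℂ} (hR : IsSiegelRing R) {a b q d α : ℂ} {m : ℕ}
    {c : Fin m → ℂ} {s t : ℕ} {P : ℂ[X]} {Q : Fin m → ℂ[X]} {F : Fin m → PowerSeries ℂ}
    {f : Fin m → ℂ → ℂ} (h : IsSystem R a b q d α c s t P Q F f) {δ ρ γ lam : ℝ}
    (hδ : 0 < δ) (hδ1 : δ < 1) (hρ : 0 < ρ) (hlam : 0 < lam) (hγ0 : 0 ≤ γ) (hγ1 : γ ≤ 1)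
    (ha : ‖a‖ = Real.exp lam) (hqn : ‖q‖ = Real.exp ((1 - γ) * lam)) :
    ∃ (κ : ℝ) (n₀ : ℕ), 1 ≤ n₀ ∧ ∀ n : ℕ, n₀ ≤ n → ∀ ν : Fin m → ℕ,
      ((∑ i, ν i : ℕ) : ℝ) ≤ (1 - δ) * n → (1 - δ) * n - m ≤ ((∑ i, ν i : ℕ) : ℝ) →
      ∀ l : Fin (m + 1) → ℂ, l ≠ 0 → ∃ p ∈ R, ∃ p' : Fin m → ℂ, (∀ i, p' i ∈ R) ∧
        l 0 * p + ∑ i : Fin m, l i.succ * p' i ≠ 0 ∧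
        ‖p‖ ≤ Real.exp (lam * ((2 - δ) ^ 2 * (1 - δ) / (2 * δ) + (ρ + δ) +
          1 / 2 * (1 + s * (ρ + δ) ^ 2)) * n ^ 2 + κ * n) ∧
        ∀ i, ‖p * f i α - p' i‖ ≤ Real.exp (lam * (((2 - δ) ^ 2 * (1 - δ) / (2 * δ) + 1 / 2 +
          γ * s * (ρ + δ) ^ 2 / 2 + γ * (ρ + δ)) * n ^ 2 +
          (γ * (ρ + δ) - ρ) * n * ν i) + κ * n) := by
  obtain ⟨C₀, hC₀, hFC⟩ := h.norm_coeff
  obtain ⟨r, hr, D, hD, hrem⟩ := h.remainder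
  obtain ⟨c₀, hc₀, hsiegel⟩ := hR.siegel
  obtain ⟨Mp, hMp1, hMp⟩ := P.exists_norm_eval_le ‖α‖
  have hq1 := h.one_lt_norm_q
  have hq0 : q ≠ 0 := by
    rintro rfl
    simp at hq1
    linarith
  have ha0 : a ≠ 0 := by
    rw [← h.b_mul_q]
    exact mul_ne_zero h.b_ne_zero hq0
  have hd1 := hR.one_le_norm d h.d_mem h.d_ne_zero
  set σ := max 1 ‖α‖ with hσ
  have hσ1 : 1 ≤ σ := le_max_left _ _
  -- One constant above all geometric bases; since x ≤ K implies x ≤ e^K, each base raised to a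
  -- power O(n) only affects κ.
  set K := c₀ + ‖d‖ + C₀ + Mp + σ + (∑ i, ‖c i‖) + D with hK
  have hcsum : 0 ≤ ∑ i, ‖c i‖ := Finset.sum_nonneg fun _ _ => norm_nonneg _
  have hK0 : 0 ≤ K := by linarith
  have hexp : ∀ x, x ≤ K → x ≤ Real.exp K := fun x hx => by
    have := Real.add_one_le_exp K
    linarith
  have kc₀ : c₀ ≤ Real.exp K := hexp _ (by linarith)
  have kd : ‖d‖ ≤ Real.exp K := hexp _ (by linarith)
  have kC : C₀ ≤ Real.exp K := hexp _ (by linarith)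
  have kM : Mp ≤ Real.exp K := hexp _ (by linarith)
  have kσ : σ ≤ Real.exp K := hexp _ (by linarith)
  have kα : ‖α‖ ≤ Real.exp K := (le_max_right _ _).trans kσ
  have kD : D ≤ Real.exp K := hexp _ (by linarith)
  have kc : ∀ i, ‖c i‖ ≤ Real.exp K := fun i => hexp _ (by
    have := Finset.single_le_sum (f := fun i => ‖c i‖) (fun _ _ => norm_nonneg _)
      (Finset.mem_univ i)
    linarith)
  obtain ⟨k₁, hk₁⟩ : ∃ k₁ : ℕ, ∀ k ≥ k₁, ‖α / q ^ k‖ ≤ r := by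
    have h1 : Filter.Tendsto (fun k : ℕ => ‖α‖ * (‖q‖⁻¹) ^ k) Filter.atTop (nhds (‖α‖ * 0)) :=
      (tendsto_pow_atTop_nhds_zero_of_lt_one (by positivity)
        (inv_lt_one_of_one_lt₀ hq1)).const_mul _
    rw [mul_zero] at h1
    obtain ⟨k₁, hk₁⟩ := Filter.eventually_atTop.1 (h1.eventually_le_const hr)
    refine ⟨k₁, fun k hk => ?_⟩
    rw [norm_div, norm_pow, div_eq_mul_inv, ← inv_pow]
    exact hk₁ k hk
  set γ₁ := (2 - δ) ^ 2 * (1 - δ) / (2 * δ) with hγ₁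
  set κ₁ := K + (1 - δ) / δ * (7 * K + 1 + lam) with hκ₁
  -- Bounded part of the window: n-M is at most δn+m, and the ceiling, the bounded degrees and the m
  -- extra rows give the rest.
  set W : ℕ := (m + 1) * (m * s + t) + 2 * m + 2 with hW
  obtain ⟨κ₂, hκ₂⟩ := exists_denominator_exponent lam K κ₁ γ₁ (ρ + δ) W s t hlam.le hK0
    (by linarith) (by positivity)
  obtain ⟨κ₃, hκ₃⟩ := exists_remainder_exponent lam K κ₁ γ₁ γ ρ (ρ + δ) W s t hlam.le hK0 hγ0 hγ1
    (by linarith) (by positivity)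
  obtain ⟨n₁, hn₁⟩ := exists_nat_gt ((m : ℝ) / (1 - δ))
  obtain ⟨n₂, hn₂⟩ := exists_nat_gt ((k₁ : ℝ) / ρ)
  -- Taking n > m/(1-δ) ensures M > 0, and n > k₁/ρ brings α/q^k into the disc of the remainder
  -- estimate.
  refine ⟨max κ₂ κ₃, n₁ + n₂ + 1, by omega, fun n hn ν hν hν' l hl => ?_⟩
  have hn1 : 1 ≤ n := by omega
  have hn1' : (1 : ℝ) ≤ n := by exact_mod_cast hn1
  set M := ∑ i, ν i with hM
  have hM0 : 0 < M := by
    rw [div_lt_iff₀ (by linarith)] at hn₁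
    have h1 : (n₁ : ℝ) ≤ n := by exact_mod_cast (by omega)
    have h2 : (n₁ : ℝ) * (1 - δ) ≤ n * (1 - δ) := mul_le_mul_of_nonneg_right h1 (by linarith)
    have : (0 : ℝ) < M := by linarith
    exact_mod_cast this
  have hMn : M ≤ n := by
    have : (M : ℝ) ≤ n := hν.trans (by nlinarith)
    exact_mod_cast this
  have hνM : ∀ i, ν i ≤ n := fun i => (Finset.single_le_sum (f := ν) (fun _ _ => Nat.zero_le _)
    (Finset.mem_univ i)).trans hMn
  obtain ⟨A, B, hA0, hAn, hAR, hAb, hBn, hBR, hX⟩ := exists_approximation hc₀ hR.one_le_norm hsiegel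
    h.a_mem ha0 h.d_mem h.d_ne_zero hC₀ hFC h.coeff_mem hM hM0 hMn
  set Y := Real.exp (lam * γ₁ * n ^ 2 + κ₁ * n) with hY
  have hAY : ∀ j, ‖A.coeff j‖ ≤ Y := fun j => (hAb j).trans
    (siegel_bound_le_exp hlam.le hK0 hδ hδ1 hc₀ hd1 hC₀ kc₀ kd kC ha hn1 hν)
  have hdet := approxDet_ne_zero (A := A) (B := B) hq1 h.c_ne_zero h.c_ne_mul_zpow h.one_le_s
    h.P_eval_zero h.not_polynomial hA0
  obtain ⟨k, hkl, hku, hk⟩ := exists_sum_approxRow_ne_zero hq1 h.c_ne_zero h.natDegree_P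
    h.natDegree_Q hAn hBn h.formal hX hdet h.α_ne_zero h.P_eval_ne_zero hl ⌈ρ * n⌉₊
    (n - M + (m + 1) * (m * s + t) + 1) (by
      have e1 : ∑ i, (n + ν i + 1) = m * n + M + m := by
        simp [Finset.sum_add_distrib, hM]
      have e2 : (m + 1) * (n + m * s + t) = m * n + n + (m + 1) * (m * s + t) := by ring
      omega)
  have hρk : ρ * n ≤ k := (Nat.le_ceil _).trans (by exact_mod_cast hkl)
  have hkθ : (k : ℝ) ≤ (ρ + δ) * n + W := by
    have e1 : (⌈ρ * n⌉₊ : ℝ) < ρ * n + 1 := Nat.ceil_lt_add_one (by positivity)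
    have e2 : (k : ℝ) + M ≤ (⌈ρ * n⌉₊ : ℝ) + n + (m + 1) * (m * s + t) + 1 + m := by
      exact_mod_cast (by omega)
    have e3 : (W : ℝ) = (m + 1) * (m * s + t) + 2 * m + 2 := by rw [hW]; push_cast; ring
    rw [e3]
    linarith
  have hk0 : (0 : ℝ) ≤ k := by positivity
  have hkk₁ : k₁ ≤ k := by
    rw [div_lt_iff₀ hρ] at hn₂
    have h1 : (n₂ : ℝ) ≤ n := by exact_mod_cast (by omega)
    have h2 : (n₂ : ℝ) * ρ ≤ n * ρ := mul_le_mul_of_nonneg_right h1 hρ.le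
    have : (k₁ : ℝ) ≤ k := by linarith
    exact_mod_cast this
  set T := k * (k + 1) / 2 with hT
  -- Common denominator of the whole row: that of the coefficients of the B_i, times the factor from
  -- `eval_numerIter_mem` at j = 0.
  set μ := d ^ (n + 1) * a ^ (n * (n + 1) / 2) * d * (d ^ (s + 1)) ^ k * a ^ (s * T) *
    (d * a ^ k) ^ (n + t) with hμ
  have hμ0 : μ ≠ 0 := by
    have := h.d_ne_zero
    simp only [hμ]
    positivity
  have hμn : ‖μ‖ ≤ Real.exp ((2 * n + 2 + t + (s + 1) * k) * K +
      (n * (n + 1) / 2 + s * (k * (k + 1) / 2) + k * (n + t)) * lam) := by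
    have e1 : μ = d ^ (2 * n + 2 + t + (s + 1) * k) *
        a ^ (n * (n + 1) / 2 + s * T + k * (n + t)) := by
      rw [hμ]
      generalize n * (n + 1) / 2 = T'
      ring
    rw [e1, norm_mul, norm_pow, norm_pow, Real.exp_add]
    refine mul_le_mul ?_ ?_ (by positivity) (by positivity)
    · refine (pow_le_exp (norm_nonneg _) kd _).trans (le_of_eq ?_)
      push_cast
      rfl
    · refine (pow_le_exp (norm_nonneg _) ha.le _).trans (le_of_eq ?_)
      push_cast
      rw [triangular_cast, hT, triangular_cast]
  have hpR := eval_denomIter_mem h.a_mem h.b_mem h.d_mem h.b_mul_q hq0 h.d_mul_α h.natDegree_P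
    h.d_mul_P hAn hAR k 0
  rw [zero_mul, zero_add, zero_add, pow_zero, div_one] at hpR
  have hp'R : ∀ i, μ * (numerIter q (c i) s P (Q i) A (B i) k).eval α ∈ R := by
    intro i
    have := eval_numerIter_mem h.a_mem h.b_mem h.d_mem (Subring.mul_mem _
      (Subring.pow_mem _ h.d_mem (n + 1)) (Subring.pow_mem _ h.a_mem (n * (n + 1) / 2)))
      h.b_mul_q hq0 h.d_mul_α (h.d_mul_c i) h.natDegree_P h.d_mul_P (h.natDegree_Q i) (h.d_mul_Q i)
      hAn hAR (hBn i) (hBR i) k 0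
    rw [zero_mul, zero_add, zero_add, pow_zero, div_one] at this
    exact this
  refine ⟨μ * (denomIter q P A k).eval α, ?_,
    fun i => μ * (numerIter q (c i) s P (Q i) A (B i) k).eval α, hp'R, ?_, ?_, fun i => ?_⟩
  · convert Subring.mul_mem _ (Subring.mul_mem _ (Subring.mul_mem _
      (Subring.pow_mem _ h.d_mem (n + 1)) (Subring.pow_mem _ h.a_mem (n * (n + 1) / 2)))
      (Subring.mul_mem _ h.d_mem (Subring.pow_mem _ (Subring.mul_mem _ h.d_mem
        (Subring.pow_mem _ h.a_mem k)) t))) hpR using 1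
    rw [hμ, pow_add (d * a ^ k)]
    ring
  · have : l 0 * (μ * (denomIter q P A k).eval α) + ∑ i : Fin m, l i.succ *
        (μ * (numerIter q (c i) s P (Q i) A (B i) k).eval α) =
        μ * ∑ i, l i * (approxRow q c s P Q A B k i).eval α := by
      rw [Fin.sum_univ_succ, mul_add, Finset.mul_sum]
      simp only [approxRow, Fin.cons_zero, Fin.cons_succ]
      congr 1
      · ring
      · exact Finset.sum_congr rfl fun i _ => by ring
    rw [this]
    exact mul_ne_zero hμ0 hk
  · have hzk : ‖α / q ^ k‖ ≤ σ := by
      rw [norm_div, norm_pow]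
      exact (div_le_self (norm_nonneg _) (one_le_pow₀ hq1.le)).trans (le_max_right _ _)
    have e1 : ‖(denomIter q P A k).eval α‖ ≤
        Real.exp (k * K + (n + (lam * γ₁ * n ^ 2 + κ₁ * n) + n * K)) := by
      refine (norm_eval_denomIter_le hq1 (by linarith) hMp k α le_rfl).trans ?_
      rw [Real.exp_add, Real.exp_add, Real.exp_add]
      refine mul_le_mul (pow_le_exp (by linarith) kM k) ?_ (norm_nonneg _) (by positivity)
      refine (Polynomial.norm_eval_le hAn hAY hσ1 hzk).trans ?_
      exact mul_le_mul (mul_le_mul_of_nonneg_right (Real.add_one_le_exp _) (by positivity))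
        (pow_le_exp (by linarith) kσ n) (by positivity) (by positivity)
    rw [norm_mul]
    refine (mul_le_mul hμn e1 (norm_nonneg _) (by positivity)).trans ?_
    rw [← Real.exp_add, Real.exp_le_exp]
    refine (hκ₂ n k hn1' hk0 hkθ).trans ?_
    gcongr
    exact le_max_left _ _
  · have e0 := denomIter_mul_sub_numerIter (A := A) (B := B i) hq0 k α (h.equation i)
    have e1 : μ * (denomIter q P A k).eval α * f i α -
        μ * (numerIter q (c i) s P (Q i) A (B i) k).eval α =
        μ * (c i ^ k * (α ^ k / q ^ T) ^ s *
          (A.eval (α / q ^ k) * f i (α / q ^ k) - (B i).eval (α / q ^ k))) := by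
      rw [← e0]
      ring
    have e2 := hrem i n (n + ν i + 1) A (B i) Y (by omega) hAn (hBn i) hAY (hX i) (α / q ^ k)
      (hk₁ k hkk₁)
    have e3 : ‖α ^ k / q ^ T‖ ≤ Real.exp (k * K - k * (k + 1) / 2 * ((1 - γ) * lam)) := by
      rw [norm_div, norm_pow, norm_pow, hqn, ← Real.exp_nat_mul, hT, triangular_cast, Real.exp_sub]
      gcongr
      exact pow_le_exp (norm_nonneg _) kα k
    have e4 : ‖α / q ^ k‖ ≤ Real.exp (K - k * ((1 - γ) * lam)) := by
      rw [norm_div, norm_pow, hqn, ← Real.exp_nat_mul, Real.exp_sub]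
      gcongr
    have e5 : ‖c i ^ k * (α ^ k / q ^ T) ^ s *
        (A.eval (α / q ^ k) * f i (α / q ^ k) - (B i).eval (α / q ^ k))‖ ≤
        Real.exp (k * K + s * (k * K - k * (k + 1) / 2 * ((1 - γ) * lam)) +
          ((lam * γ₁ * n ^ 2 + κ₁ * n) + (n + ν i + 2) * K +
            (n + ν i + 1) * (K - k * ((1 - γ) * lam)))) := by
      rw [norm_mul, norm_mul, norm_pow, norm_pow _ s, Real.exp_add, Real.exp_add, Real.exp_add,
        Real.exp_add]
      have g1 : D ^ (n + ν i + 1 + 1) ≤ Real.exp ((n + ν i + 2) * K) := by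
        refine (pow_le_exp (by linarith) kD _).trans (le_of_eq ?_)
        push_cast
        ring_nf
      have g2 : ‖α / q ^ k‖ ^ (n + ν i + 1) ≤
          Real.exp ((n + ν i + 1) * (K - k * ((1 - γ) * lam))) := by
        refine (pow_le_exp (norm_nonneg _) e4 _).trans (le_of_eq ?_)
        push_cast
        rfl
      refine mul_le_mul (mul_le_mul (pow_le_exp (norm_nonneg _) (kc i) k)
        (pow_le_exp (norm_nonneg _) e3 s) (by positivity) (by positivity))
        (e2.trans ?_) (norm_nonneg _) (by positivity)
      exact mul_le_mul (mul_le_mul_of_nonneg_left g1 (by positivity)) g2 (by positivity)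
        (by positivity)
    rw [e1, norm_mul]
    refine (mul_le_mul hμn e5 (norm_nonneg _) (by positivity)).trans ?_
    rw [← Real.exp_add, Real.exp_le_exp]
    refine (hκ₃ n k (ν i) hn1' hk0 hkθ hρk (by positivity) (by exact_mod_cast hνM i)).trans ?_
    gcongr
    exact le_max_right _ _

end QDifference

/-! ### From weighted approximations to the lower bound. -/

/-- Baker-type lower bounds follow from simultaneous approximations with arbitrary weights. -/
theorem exists_linear_form_lower_bound {R : Subring ℂ} (hR : ∀ x ∈ R, x ≠ 0 → 1 ≤ ‖x‖) {m : ℕ}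
    (hm : 1 ≤ m) (φ : Fin m → ℂ) {lam δ γ₂ γ₄ γ₅ G κ : ℝ} {n₀ : ℕ} (hlam : 0 < lam)
    (hγ₂ : 0 ≤ γ₂) (hG : 0 ≤ G) (hγ₄ : γ₄ = G + δ * γ₅ / m) (hγ₅ : 0 < γ₅)
    (hg : 0 < γ₅ - m * γ₄) (hn₀ : 1 ≤ n₀)
    (H : ∀ n : ℕ, n₀ ≤ n → ∀ ν : Fin m → ℕ,
      ((∑ i, ν i : ℕ) : ℝ) ≤ (1 - δ) * n → (1 - δ) * n - m ≤ ((∑ i, ν i : ℕ) : ℝ) →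
      ∀ l : Fin (m + 1) → ℂ, l ≠ 0 → ∃ p ∈ R, ∃ p' : Fin m → ℂ, (∀ i, p' i ∈ R) ∧
        l 0 * p + ∑ i : Fin m, l i.succ * p' i ≠ 0 ∧
        ‖p‖ ≤ Real.exp (lam * γ₂ * n ^ 2 + κ * n) ∧
        ∀ i, ‖p * φ i - p' i‖ ≤ Real.exp (lam * (G * n ^ 2 - γ₅ * n * ν i) + κ * n))
    {ε : ℝ} (hε : 0 < ε) :
    ∃ C₀ : ℝ, 0 < C₀ ∧ ∀ l : Fin (m + 1) → ℂ, (∀ i, l i ∈ R) → l ≠ 0 →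
      C₀ * (∏ i : Fin m, max 1 ‖l i.succ‖) ^ (-(γ₂ / (γ₅ - m * γ₄)) - ε) <
        ‖l 0 + ∑ i : Fin m, l i.succ * φ i‖ := by
  have hm' : (1 : ℝ) ≤ m := by exact_mod_cast hm
  have hm0 : (m : ℝ) ≠ 0 := by positivity
  set g := γ₅ - m * γ₄ with hgdef
  set κ' := max κ 0 with hκ'
  have hκκ' : κ ≤ κ' := le_max_left _ _
  have hκ'0 : 0 ≤ κ' := le_max_right _ _
  have hlog : 0 ≤ Real.log (2 * m) := Real.log_nonneg (by linarith)
  set C₁ := lam * γ₅ + κ' + Real.log (2 * m) with hC₁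
  have hC₁0 : 0 ≤ C₁ := by positivity
  obtain ⟨N₀, hN₀⟩ := exists_nat_ge (m * C₁ / (lam * g))
  have hlg : 0 < lam * g := by positivity
  set N := N₀ + n₀ with hN
  have hNC : m * C₁ ≤ lam * g * N := by
    rw [div_le_iff₀ hlg] at hN₀
    have : (N₀ : ℝ) * (lam * g) ≤ N * (lam * g) := by
      gcongr
      omega
    linarith
  set c : ℝ := N + 1 with hc
  have hc0 : 0 ≤ c := by positivity
  set β := 2 * lam * γ₂ * c + κ' with hβ
  set C₃ := β ^ 2 / (4 * ε * (lam * g)) + lam * γ₂ * c ^ 2 + κ' * c with hC₃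
  refine ⟨1 / 4 * Real.exp (-C₃), by positivity, fun l hlR hl => ?_⟩
  set h : Fin m → ℝ := fun i => Real.log (max 1 ‖l i.succ‖) with hh
  have hmax : ∀ i : Fin m, 0 < max 1 ‖l i.succ‖ := fun i => lt_max_of_lt_left one_pos
  have hh0 : ∀ i, 0 ≤ h i := fun i => Real.log_nonneg (le_max_left _ _)
  have hexph : ∀ i, Real.exp (h i) = max 1 ‖l i.succ‖ := fun i => Real.exp_log (hmax i)
  set S := ∑ i, h i with hS
  have hS0 : 0 ≤ S := Finset.sum_nonneg fun i _ => hh0 i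
  have hprod : ∏ i : Fin m, max 1 ‖l i.succ‖ = Real.exp S := by
    rw [hS, Real.exp_sum]
    exact Finset.prod_congr rfl fun i _ => (hexph i).symm
  -- The real optimum for n: λg·x² equals the logarithm of the product of the heights.
  set x := Real.sqrt (S / (lam * g)) with hx
  have hx0 : 0 ≤ x := Real.sqrt_nonneg _
  have hx2 : lam * g * x ^ 2 = S := by
    rw [hx, Real.sq_sqrt (by positivity)]
    field_simp
  set n := ⌈x⌉₊ + N with hn
  have hnn₀ : n₀ ≤ n := by omega
  have hn1 : (1 : ℝ) ≤ n := by exact_mod_cast hn₀.trans hnn₀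
  have hnl : x + N ≤ n := by
    rw [hn]; push_cast
    have := Nat.le_ceil x
    linarith
  have hnu : (n : ℝ) ≤ x + c := by
    rw [hn, hc]; push_cast
    have := Nat.ceil_lt_add_one hx0
    linarith
  -- The surplus from taking n a bounded amount above x. The shift N makes it nonnegative, and it is
  -- shared equally so that the y_i sum to exactly 1.
  set e := lam * g * n ^ 2 - m * C₁ * n - S with he
  have he0 : 0 ≤ e := by
    have h1 : lam * g * x ≤ lam * g * n - m * C₁ := by
      have : lam * g * (x + N) ≤ lam * g * n := by gcongr
      linarith
    have h2 : lam * g * x * x ≤ (lam * g * n - m * C₁) * n := by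
      have hxn : x ≤ n := by
        have : (0 : ℝ) ≤ N := by positivity
        linarith
      have : 0 ≤ lam * g * x := by positivity
      exact mul_le_mul h1 hxn hx0 (by linarith)
    rw [he]
    linarith
  have hden : 0 < lam * γ₅ * n ^ 2 := by positivity
  set y : Fin m → ℝ := fun i => (h i + lam * γ₄ * n ^ 2 + C₁ * n + e / m) / (lam * γ₅ * n ^ 2)
    with hy
  have hymul : ∀ i, lam * γ₅ * n ^ 2 * y i = h i + lam * γ₄ * n ^ 2 + C₁ * n + e / m := fun i => by
    rw [hy]
    field_simp
  have hysum : ∑ i, y i = 1 := by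
    rw [hy, ← Finset.sum_div, div_eq_one_iff_eq hden.ne']
    simp only [Finset.sum_add_distrib, Finset.sum_const, Finset.card_univ, Fintype.card_fin,
      nsmul_eq_mul]
    rw [← hS, mul_div_cancel₀ e hm0, he, hgdef]
    ring
  have hyδ : ∀ i, δ / m ≤ y i := by
    intro i
    rw [hy, le_div_iff₀ hden, hγ₄]
    have h1 := hh0 i
    have h2 : 0 ≤ lam * G * n ^ 2 := by positivity
    have h3 : 0 ≤ C₁ * n := by positivity
    have h4 : 0 ≤ e / m := by positivity
    have h5 : δ / m * (lam * γ₅ * n ^ 2) = lam * (δ * γ₅ / m) * n ^ 2 := by ring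
    rw [h5]
    linarith
  -- Subtracting δ/m from each y_i brings the total down to (1-δ)n, which is why γ₄ contains δγ₅/m.
  -- Rounding down loses at most 1 per weight, hence the tolerance m in `H`.
  let ν : Fin m → ℕ := fun i => ⌊n * (y i - δ / m)⌋₊
  have hνu : ∀ i, (ν i : ℝ) ≤ n * (y i - δ / m) := fun i =>
    Nat.floor_le (mul_nonneg (by positivity) (by linarith [hyδ i]))
  have hνl : ∀ i, n * (y i - δ / m) - 1 ≤ (ν i : ℝ) := fun i => (Nat.sub_one_lt_floor _).le
  have hsum : ∑ i : Fin m, (n : ℝ) * (y i - δ / m) = (1 - δ) * n := by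
    rw [← Finset.mul_sum, Finset.sum_sub_distrib, hysum]
    simp only [Finset.sum_const, Finset.card_univ, Fintype.card_fin, nsmul_eq_mul]
    rw [mul_div_cancel₀ δ hm0]
    ring
  obtain ⟨p, hpR, p', hp'R, hne, hpn, hrem⟩ := H n hnn₀ ν
    (by push_cast; rw [← hsum]; exact Finset.sum_le_sum fun i _ => hνu i)
    (by
      push_cast
      have := Finset.sum_le_sum fun (i : Fin m) (_ : i ∈ Finset.univ) => hνl i
      rw [Finset.sum_sub_distrib, hsum] at this
      simpa using this) l hl
  have hone := hR _ (Subring.add_mem _ (Subring.mul_mem _ (hlR 0) hpR)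
    (Subring.sum_mem _ fun (i : Fin m) _ => Subring.mul_mem _ (hlR i.succ) (hp'R i))) hne
  have hsmall : ∀ i, ‖l i.succ * (p * φ i - p' i)‖ ≤ 1 / (2 * m) := by
    intro i
    rw [norm_mul]
    calc ‖l i.succ‖ * ‖p * φ i - p' i‖ ≤
          Real.exp (h i) * Real.exp (lam * (G * n ^ 2 - γ₅ * n * ν i) + κ * n) := by
          refine mul_le_mul ?_ (hrem i) (norm_nonneg _) (by positivity)
          rw [hexph]
          exact le_max_right _ _
      _ ≤ Real.exp (-Real.log (2 * m)) := by
          rw [← Real.exp_add, Real.exp_le_exp]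
          have h1 : lam * γ₅ * n * (n * (y i - δ / m) - 1) ≤ lam * γ₅ * n * ν i :=
            mul_le_mul_of_nonneg_left (hνl i) (by positivity)
          have h2 : lam * γ₅ * n * (n * (y i - δ / m) - 1) =
              h i + lam * G * n ^ 2 + C₁ * n + e / m - lam * γ₅ * n := by
            have := hymul i
            rw [hγ₄] at this
            have h5 : δ / m * (lam * γ₅ * n ^ 2) = lam * (δ * γ₅ / m) * n ^ 2 := by ring
            linarith
          have h3 : 0 ≤ e / m := by positivity
          have h4 : κ * n ≤ κ' * n := by gcongr
          have h5 : Real.log (2 * m) ≤ Real.log (2 * m) * n := le_mul_of_one_le_right hlog hn1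
          have h6 : C₁ * n = lam * γ₅ * n + κ' * n + Real.log (2 * m) * n := by rw [hC₁]; ring
          linarith
      _ = 1 / (2 * m) := by
          rw [Real.exp_neg, Real.exp_log (by positivity), one_div]
  set Λ := l 0 + ∑ i : Fin m, l i.succ * φ i with hΛ
  have hid : l 0 * p + ∑ i : Fin m, l i.succ * p' i =
      p * Λ - ∑ i : Fin m, l i.succ * (p * φ i - p' i) := by
    rw [hΛ, mul_add, Finset.mul_sum, add_sub_assoc, ← Finset.sum_sub_distrib]
    congr 1
    · ring
    · exact Finset.sum_congr rfl fun i _ => by ring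
  have hhalf : ‖∑ i : Fin m, l i.succ * (p * φ i - p' i)‖ ≤ 1 / 2 := by
    refine (norm_sum_le_of_le _ fun i _ => hsmall i).trans (le_of_eq ?_)
    simp only [Finset.sum_const, Finset.card_univ, Fintype.card_fin, nsmul_eq_mul]
    field_simp
  have hpΛ : 1 / 2 ≤ ‖p‖ * ‖Λ‖ := by
    rw [hid] at hone
    have := hone.trans (norm_sub_le _ _)
    rw [norm_mul] at this
    linarith
  have hexp : lam * γ₂ * n ^ 2 + κ * n ≤ (γ₂ / g + ε) * S + C₃ := by
    have h1 : lam * γ₂ * (n : ℝ) ^ 2 ≤ lam * γ₂ * (x + c) ^ 2 := by gcongr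
    have h2 : κ * n ≤ κ' * (x + c) := by
      calc κ * n ≤ κ' * n := by gcongr
        _ ≤ κ' * (x + c) := by gcongr
    -- Completing the square: the term linear in x, of order √S, is absorbed by εS and a constant.
    have h3 : β * x ≤ ε * S + β ^ 2 / (4 * ε * (lam * g)) := by
      rw [← hx2]
      have h4 : 0 < 4 * ε * (lam * g) := by positivity
      have h5 : 0 ≤ (2 * ε * (lam * g) * x - β) ^ 2 / (4 * ε * (lam * g)) := by positivity
      have h6 : (2 * ε * (lam * g) * x - β) ^ 2 / (4 * ε * (lam * g)) =
          ε * (lam * g * x ^ 2) + β ^ 2 / (4 * ε * (lam * g)) - β * x := by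
        field_simp
        ring
      linarith
    have h7 : γ₂ / g * S = lam * γ₂ * x ^ 2 := by
      rw [← hx2]
      field_simp
    have h8 : β * x = 2 * lam * γ₂ * c * x + κ' * x := by rw [hβ]; ring
    rw [hC₃, add_mul, h7]
    linarith
  have hp2 : ‖p‖ ≤ Real.exp ((γ₂ / g + ε) * S + C₃) :=
    hpn.trans (Real.exp_le_exp.2 hexp)
  rw [hprod, ← Real.exp_mul, mul_assoc, ← Real.exp_add]
  have hE : -C₃ + S * (-(γ₂ / g) - ε) = -((γ₂ / g + ε) * S + C₃) := by ring
  rw [hE, Real.exp_neg]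
  have hpos := Real.exp_pos ((γ₂ / g + ε) * S + C₃)
  have : 1 / 2 ≤ Real.exp ((γ₂ / g + ε) * S + C₃) * ‖Λ‖ :=
    hpΛ.trans (mul_le_mul_of_nonneg_right hp2 (norm_nonneg _))
  rw [← div_eq_mul_inv, div_lt_iff₀ hpos]
  linarith

/-! ### The data over K form a system; proof of the theorem. -/

-- P has no zero near 0, and multiplication by q^k moves zeros outwards.
open Filter Topology in
theorem compl_poleSet_mem_nhds {K : IntermediateField ℚ ℂ} {q : K} (hq : 1 < ‖(q : ℂ)‖) {P : K[X]}
    (hP0 : (P.map (algebraMap K ℂ)).eval 0 ≠ 0) : (poleSet q P)ᶜ ∈ 𝓝 (0 : ℂ) := by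
  have h1 : ∀ᶠ z in 𝓝 (0 : ℂ), (P.map (algebraMap K ℂ)).eval z ≠ 0 :=
    (P.map (algebraMap K ℂ)).continuous.continuousAt.eventually_ne hP0
  obtain ⟨r, hr, hball⟩ := Metric.eventually_nhds_iff_ball.1 h1
  filter_upwards [Metric.ball_mem_nhds (0 : ℂ) hr] with z hz
  rintro ⟨k, -, β, hβ, rfl⟩
  rw [mem_ball_zero_iff, norm_mul, norm_pow] at hz
  refine hball β ?_ ?_
  · rw [mem_ball_zero_iff]
    exact (le_mul_of_one_le_left (norm_nonneg _) (one_le_pow₀ hq.le)).trans_lt hz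
  · rwa [Polynomial.eval_map_algebraMap]

theorem mul_coeff_mem {R : Subring ℂ} {p : ℂ[X]} {d e : ℂ}
    (h : ∀ x ∈ p.coeffs, d * (x / e) ∈ R) (j : ℕ) : d * (p.coeff j / e) ∈ R := by
  by_cases hj : p.coeff j = 0
  · rw [hj, zero_div, mul_zero]
    exact Subring.zero_mem _
  · exact h _ (Polynomial.coeff_mem_coeffs hj)

open QDifference Filter Topology in
theorem exists_isSystem {K : IntermediateField ℚ ℂ} (hK : IsRatOrImagQuadratic K) {a b : 𝓞 K} {q : K}
    (hb : ((b : K) : ℂ) ≠ 0) (hqab : ((b : K) : ℂ) * q = ((a : K) : ℂ)) (hq : 1 < ‖(q : ℂ)‖) {s : ℕ}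
    (hs : 1 ≤ s) {P : K[X]} (hPdeg : P.natDegree ≤ s) (hP0 : P.eval 0 ≠ 0) {m : ℕ} (hm : 1 ≤ m)
    {αs : Fin m → K} (hαs : ∀ i, αs i ≠ 0)
    (hαsq : ∀ i j, i ≠ j → ∀ l : ℤ, αs i ≠ αs j * q ^ l)
    {Q : Fin m → K[X]} {f : Fin m → ℂ → ℂ} (hf : ∀ i, IsAnalyticSolution q (αs i) s P (Q i) (f i))
    (hfpoly : ∀ i, ¬ ∃ p : ℂ[X], ∀ z ∉ poleSet q P, f i z = p.eval z)
    {α : K} (hα : α ≠ 0) (hαP : ∀ k : ℕ, 1 ≤ k → P.eval (α * (q ^ k)⁻¹) ≠ 0) :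
    ∃ (d : ℂ) (t : ℕ) (F : Fin m → PowerSeries ℂ), IsSystem (integersInComplex K) ((a : K) : ℂ)
      ((b : K) : ℂ) (q : ℂ) d (α : ℂ) (fun i => (αs i : ℂ)) s t (P.map (algebraMap K ℂ))
      (fun i => (Q i).map (algebraMap K ℂ)) F f := by
  classical
  have : Nonempty (Fin m) := ⟨⟨0, hm⟩⟩
  set P' := P.map (algebraMap K ℂ) with hP'
  set Q' : Fin m → ℂ[X] := fun i => (Q i).map (algebraMap K ℂ) with hQ'
  have hcoe : ∀ x : K, algebraMap K ℂ x = (x : ℂ) := fun _ => rfl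
  have hPev : ∀ x : K, P'.eval (x : ℂ) = ((P.eval x : K) : ℂ) := fun x => by
    rw [hP', ← hcoe, Polynomial.eval_map_apply, hcoe]
  have hP0' : P'.eval 0 ≠ 0 := by
    have := hPev 0
    rw [ZeroMemClass.coe_zero] at this
    rw [this]
    simpa using hP0
  have hPc0 : P'.coeff 0 ≠ 0 := by rwa [Polynomial.coeff_zero_eq_eval_zero]
  have hq0 : (q : ℂ) ≠ 0 := by
    intro h
    rw [h, norm_zero] at hq
    linarith
  have hPs : P'.natDegree ≤ s := Polynomial.natDegree_map_le.trans hPdeg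
  have hPK : ∀ x ∈ P'.coeffs, x ∈ K := by
    intro x hx
    obtain ⟨j, -, rfl⟩ := Polynomial.mem_coeffs_iff.1 hx
    rw [hP', Polynomial.coeff_map]
    exact (P.coeff j).2
  have hQK : ∀ i, ∀ x ∈ (Q' i).coeffs, x ∈ K := by
    intro i x hx
    obtain ⟨j, -, rfl⟩ := Polynomial.mem_coeffs_iff.1 hx
    rw [hQ', Polynomial.coeff_map]
    exact ((Q i).coeff j).2
  have hp₀K : P'.coeff 0 ∈ K := by
    rw [hP', Polynomial.coeff_map]
    exact (P.coeff 0).2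
  let S₀ : Finset ℂ := {(α : ℂ)} ∪ Finset.univ.image (fun i => (αs i : ℂ)) ∪ P'.coeffs ∪
    Finset.univ.biUnion fun i => (Q' i).coeffs
  -- Both x and x/P(0) need clearing, because the recurrence for the coefficients divides by P(0).
  obtain ⟨d, hd, hd0, hdS⟩ := hK.exists_common_denominator (S₀ ∪ S₀.image (· / P'.coeff 0)) (by
    have hS₀ : ∀ x ∈ S₀, x ∈ K := by
      intro x hx
      simp only [S₀, Finset.mem_union, Finset.mem_singleton, Finset.mem_image, Finset.mem_univ,
        true_and, Finset.mem_biUnion] at hx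
      rcases hx with ((rfl | ⟨i, rfl⟩) | hx) | ⟨i, hx⟩
      · exact α.2
      · exact (αs i).2
      · exact hPK x hx
      · exact hQK i x hx
    intro x hx
    rcases Finset.mem_union.1 hx with hx | hx
    · exact hS₀ x hx
    · obtain ⟨y, hy, rfl⟩ := Finset.mem_image.1 hx
      exact div_mem (hS₀ y hy) hp₀K)
  have hd1 : ∀ x ∈ S₀, d * (x / 1) ∈ integersInComplex K := fun x hx => by
    rw [div_one]
    exact hdS x (Finset.mem_union_left _ hx)
  have hd2 : ∀ x ∈ S₀, d * (x / P'.coeff 0) ∈ integersInComplex K := fun x hx =>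
    hdS _ (Finset.mem_union_right _ (Finset.mem_image_of_mem _ hx))
  have mα : (α : ℂ) ∈ S₀ := by simp [S₀]
  have mc : ∀ i, (αs i : ℂ) ∈ S₀ := fun i => by simp [S₀]
  have mP : ∀ x ∈ P'.coeffs, x ∈ S₀ := fun x hx => by simp [S₀, hx]
  have mQ : ∀ i, ∀ x ∈ (Q' i).coeffs, x ∈ S₀ := fun i x hx =>
    Finset.mem_union_right _ (Finset.mem_biUnion.2 ⟨i, Finset.mem_univ i, hx⟩)
  have haR : ((a : K) : ℂ) ∈ integersInComplex K := ⟨a, rfl⟩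
  have hbR : ((b : K) : ℂ) ∈ integersInComplex K := ⟨b, rfl⟩
  have hF := fun i => exists_isFormalSolution (c := (αs i : ℂ)) (P := P') (Q := Q' i) haR hbR hd hqab
    hq hs hPs hPc0 (hd2 _ (mc i)) (mul_coeff_mem fun x hx => hd2 x (mP x hx))
    (mul_coeff_mem fun x hx => hd2 x (mQ i x hx))
  choose F hFormal hFsize hFmem using hF
  choose C hC1 hC using hFsize
  have hnhds := compl_poleSet_mem_nhds hq hP0'
  have h0 : (0 : ℂ) ∉ poleSet q P := mem_of_mem_nhds hnhds
  have hcont : ∀ i, ContinuousAt (f i) 0 := fun i => ((hf i).analytic 0 h0).continuousAt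
  have heq : ∀ i, ∀ z : ℂ, (q : ℂ) * z ∉ poleSet q P →
      (αs i : ℂ) * z ^ s * f i z = P'.eval z * f i ((q : ℂ) * z) + (Q' i).eval z := by
    intro i z hz
    rw [(hf i).equation z hz, hP', hQ', Polynomial.eval_map_algebraMap,
      Polynomial.eval_map_algebraMap]
  have hev : ∀ i, ∀ᶠ z in 𝓝 (0 : ℂ),
      (αs i : ℂ) * z ^ s * f i z = P'.eval z * f i ((q : ℂ) * z) + (Q' i).eval z := by
    intro i
    have h2 : Tendsto (fun w : ℂ => (q : ℂ) * w) (𝓝 0) (𝓝 0) := by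
      have : Continuous fun w : ℂ => (q : ℂ) * w := by fun_prop
      simpa using this.tendsto 0
    filter_upwards [h2.eventually hnhds] with z hz
    exact heq i z hz
  have hrem := fun i => exists_norm_mul_sub_le hq hs hPc0 (hFormal i) (hC1 i) (hC i) (hcont i) (hev i)
  choose r hr D hD1 hrem using hrem
  obtain ⟨i₁, hi₁⟩ := Finite.exists_max C
  obtain ⟨i₂, hi₂⟩ := Finite.exists_max D
  obtain ⟨i₃, hi₃⟩ := Finite.exists_min r
  have hPα : ∀ k : ℕ, 1 ≤ k → P'.eval ((α : ℂ) / (q : ℂ) ^ k) ≠ 0 := by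
    intro k hk
    have := hPev (α * (q ^ k)⁻¹)
    push_cast at this
    rw [div_eq_mul_inv, this]
    simpa using hαP k hk
  refine ⟨d, Finset.univ.sup fun i => (Q' i).natDegree, F, ?_⟩
  refine
    { a_mem := haR
      b_mem := hbR
      d_mem := hd
      b_ne_zero := hb
      d_ne_zero := hd0
      b_mul_q := hqab
      one_lt_norm_q := hq
      c_ne_zero := fun i => by simpa using hαs i
      c_ne_mul_zpow := fun i j hij l h => hαsq i j hij l (Subtype.ext (by push_cast; exact h))
      one_le_s := hs
      natDegree_P := hPs
      P_eval_zero := hP0'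
      natDegree_Q := fun i => Finset.le_sup (f := fun i => (Q' i).natDegree) (Finset.mem_univ i)
      not_polynomial := ?_
      α_ne_zero := by simpa using hα
      P_eval_ne_zero := hPα
      d_mul_α := by simpa using hd1 _ mα
      d_mul_c := fun i => by simpa using hd1 _ (mc i)
      d_mul_P := fun j => by simpa using mul_coeff_mem (fun x hx => hd1 x (mP x hx)) j
      d_mul_Q := fun i j => by simpa using mul_coeff_mem (fun x hx => hd1 x (mQ i x hx)) j
      coeff_mem := hFmem
      formal := hFormal
      norm_coeff := ⟨C i₁, hC1 i₁, fun i n => (hC i n).trans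
        (pow_le_pow_left₀ (by linarith [hC1 i]) (hi₁ i) _)⟩
      remainder := ⟨r i₃, hr i₃, D i₂, hD1 i₂, ?_⟩
      equation := ?_ }
  · rintro i ⟨p, hp⟩
    refine hfpoly i ⟨p, fun z hz => eq_eval_of_polynomial_solution hq hs hP0' (hcont i) hnhds ?_
      (heq i) hp hz⟩
    intro z hz
    refine ⟨?_, fun h => hz ⟨1, le_rfl, z / q, ?_, ?_⟩⟩
    · rintro ⟨k, hk, β, hβ, h⟩
      refine hz ⟨k + 1, by omega, β, hβ, ?_⟩
      rw [pow_succ', mul_assoc, ← h, mul_div_cancel₀ z hq0]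
    · rwa [hP', Polynomial.eval_map_algebraMap] at h
    · rw [pow_one, mul_div_cancel₀ z hq0]
  · intro i n N A B Y hnN hA hB hAY hX z hz
    have hY : 0 ≤ Y := (norm_nonneg _).trans (hAY 0)
    refine (hrem i n N A B Y hnN hA hB hAY hX z (hz.trans (hi₃ i))).trans ?_
    have := hD1 i
    have := hi₂ i
    gcongr
  -- If α/q^(k-1) were q^jβ with P(β) = 0, then β = α/q^(k-1+j) would be one of the excluded zeros.
  · intro i k hk
    refine heq i _ ?_
    rintro ⟨j, hj, β, hβ, h⟩
    refine hPα (k - 1 + j) (by omega) ?_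
    have : (α : ℂ) / (q : ℂ) ^ (k - 1 + j) = β := by
      obtain ⟨k', rfl⟩ : ∃ k', k = k' + 1 := ⟨k - 1, by omega⟩
      rw [Nat.add_sub_cancel, pow_add, ← div_div, div_eq_iff (pow_ne_zero _ hq0), mul_comm β, ← h,
        pow_succ]
      field_simp
    rw [this, hP', Polynomial.eval_map_algebraMap]
    exact hβ

theorem theorem2
    (K : IntermediateField ℚ ℂ) (hK : IsRatOrImagQuadratic K)
    (a b : 𝓞 K) (q : K) (hqab : q = (a : K) / (b : K)) (hq : 1 < ‖(q : ℂ)‖)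
    (s : ℕ) (hs : 1 ≤ s)
    (P : K[X]) (hPdeg : P.natDegree ≤ s) (hP0 : P.eval 0 ≠ 0)
    (m : ℕ) (hm : 1 ≤ m)
    (αs : Fin m → K) (hαs : ∀ i, αs i ≠ 0)
    (hαsq : ∀ i j, i ≠ j → ∀ l : ℤ, αs i ≠ αs j * q ^ l)
    (Q : Fin m → K[X]) (hQ : ∀ i, Q i ≠ 0)
    (f : Fin m → ℂ → ℂ) (hf : ∀ i, IsAnalyticSolution q (αs i) s P (Q i) (f i))
    (hfpoly : ∀ i, ¬ ∃ p : ℂ[X], ∀ z ∉ poleSet q P, f i z = p.eval z)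
    (α : K) (hα : α ≠ 0) (hαP : ∀ k : ℕ, 1 ≤ k → P.eval (α * (q ^ k)⁻¹) ≠ 0)
    (δ₀ ρ₀ γ γ₁ γ₂ γ₃ γ₄ γ₅ : ℝ)
    (hγ : γ = Real.log ‖((b : K) : ℂ)‖ / Real.log ‖((a : K) : ℂ)‖)
    (hγ₁ : γ₁ = (2 - δ₀) ^ 2 * (1 - δ₀) / (2 * δ₀))
    (hγ₂ : γ₂ = γ₁ + ρ₀ + δ₀ + (1 / 2) * (1 + s * (ρ₀ + δ₀) ^ 2))
    (hγ₃ : γ₃ = γ₁ + 1 / 2 + δ₀ * ρ₀ / m)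
    (hγ₄ : γ₄ = γ₃ + γ * (ρ₀ + δ₀) * (1 - δ₀ / m + s * ((ρ₀ + δ₀) / 2)))
    (hγ₅ : γ₅ = ρ₀ - γ * (ρ₀ + δ₀))
    (hδ₀ : 0 < δ₀) (hδ₀' : δ₀ < 1)
    (hρ₀ : m * (γ₁ + 1 / 2) / (1 - δ₀) < ρ₀)
    (hγlt : γ < (ρ₀ - m * γ₃) / ((ρ₀ + δ₀) * (1 + s * m * (ρ₀ + δ₀) / 2 + m - δ₀))) :
    ∀ ε₀ : ℝ, 0 < ε₀ → ∃ C₀ : ℝ, 0 < C₀ ∧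
      ∀ l : Fin (m + 1) → 𝓞 K, l ≠ 0 →
        C₀ * (∏ i : Fin m, max 1 ‖((l i.succ : K) : ℂ)‖) ^ (-(γ₂ / (γ₅ - m * γ₄)) - ε₀) <
          ‖((l 0 : K) : ℂ) + ∑ i : Fin m, ((l i.succ : K) : ℂ) * f i (α : ℂ)‖ := by
  intro ε₀ hε₀
  have hR := hK.isSiegelRing
  set A := ‖((a : K) : ℂ)‖ with hA
  set B := ‖((b : K) : ℂ)‖ with hB
  have hqC : (q : ℂ) = ((a : K) : ℂ) / ((b : K) : ℂ) := by rw [hqab]; push_cast; rfl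
  have hb : ((b : K) : ℂ) ≠ 0 := by
    intro h
    rw [hqC, h, div_zero, norm_zero] at hq
    linarith
  have hB1 : 1 ≤ B := hR.one_le_norm _ ⟨b, rfl⟩ hb
  have hAB : ‖(q : ℂ)‖ = A / B := by rw [hqC, norm_div]
  have hBA : B < A := by
    rw [hAB, one_lt_div (by linarith)] at hq
    exact hq
  set lam := Real.log A with hlam
  have hlam0 : 0 < lam := Real.log_pos (by linarith)
  have hlB : Real.log B = γ * lam := by rw [hγ]; field_simp
  have hγ0 : 0 ≤ γ := by
    rw [hγ]
    exact div_nonneg (Real.log_nonneg hB1) hlam0.le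
  have hγ1 : γ ≤ 1 := by
    rw [hγ, div_le_one hlam0]
    exact Real.log_le_log (by linarith) hBA.le
  have hqn : ‖(q : ℂ)‖ = Real.exp ((1 - γ) * lam) := by
    rw [sub_mul, one_mul, Real.exp_sub, ← hlB, hlam, Real.exp_log (by linarith),
      Real.exp_log (by linarith), hAB]
  have hm1 : (1 : ℝ) ≤ m := by exact_mod_cast hm
  have hm0 : (m : ℝ) ≠ 0 := by positivity
  have hγ₁0 : 0 ≤ γ₁ := by
    rw [hγ₁]
    have : 0 ≤ 1 - δ₀ := by linarith
    positivity
  have hδ1 : 0 < 1 - δ₀ := by linarith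
  have hρ0 : 0 < ρ₀ := lt_of_le_of_lt (by positivity) hρ₀
  have hθ : 0 < ρ₀ + δ₀ := by linarith
  have hδm : δ₀ / m ≤ 1 := by
    rw [div_le_one (by linarith)]
    linarith
  have hγ₃0 : 0 ≤ γ₃ := by
    rw [hγ₃]
    positivity
  have hγ₄0 : 0 ≤ γ₄ := by
    rw [hγ₄]
    have h1 : 0 ≤ 1 - δ₀ / m := by linarith
    positivity
  -- After multiplication by its positive denominator, the assumed bound on γ is exactly γ₅ > mγ₄.
  have hg : 0 < γ₅ - m * γ₄ := by
    have h1 : 0 ≤ s * m * (ρ₀ + δ₀) / 2 := by positivity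
    have h2 : 0 < (ρ₀ + δ₀) * (1 + s * m * (ρ₀ + δ₀) / 2 + m - δ₀) :=
      mul_pos hθ (by linarith)
    rw [lt_div_iff₀ h2] at hγlt
    have h3 : m * γ₄ = m * γ₃ + γ * (ρ₀ + δ₀) * (m - δ₀ + s * m * (ρ₀ + δ₀) / 2) := by
      rw [hγ₄]
      field_simp
    rw [h3, hγ₅]
    linarith
  have hγ₅0 : 0 < γ₅ := by
    have : 0 ≤ m * γ₄ := by positivity
    linarith
  have hγ₂0 : 0 ≤ γ₂ := by
    rw [hγ₂]
    positivity
  obtain ⟨d, t, F, hsys⟩ := exists_isSystem (a := a) hK hb (by rw [hqC]; field_simp) hq hs hPdeg hP0 hm hαs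
    hαsq hf hfpoly hα hαP
  obtain ⟨κ, n₀, hn₀, H⟩ := hsys.exists_integral_forms hR hδ₀ hδ₀' hρ0 hlam0 hγ0 hγ1
    (Real.exp_log (by linarith)).symm hqn
  -- `G` is γ₄ - δ₀γ₅/m; the terms δ₀ρ₀/m in γ₃ and -δ₀/m in γ₄ are precisely this correction for
  -- the weights.
  obtain ⟨C₀, hC₀, hmain⟩ := exists_linear_form_lower_bound hR.one_le_norm hm
    (fun i => f i (α : ℂ)) (γ₂ := γ₂) (γ₄ := γ₄) (γ₅ := γ₅) (δ := δ₀)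
    (G := γ₁ + 1 / 2 + γ * s * (ρ₀ + δ₀) ^ 2 / 2 + γ * (ρ₀ + δ₀)) (κ := κ) hlam0 hγ₂0
    (by positivity) (by rw [hγ₄, hγ₃, hγ₅]; field_simp; ring) hγ₅0 hg hn₀
    (fun n hn ν h1 h2 l hl => by
      obtain ⟨p, hp, p', hp', hne, hpn, hrem⟩ := H n hn ν h1 h2 l hl
      refine ⟨p, hp, p', hp', hne, hpn.trans (le_of_eq ?_), fun i =>
        (hrem i).trans (le_of_eq ?_)⟩
      · rw [hγ₂, hγ₁]
        ring_nf
      · rw [hγ₅, hγ₁]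
        ring_nf) hε₀
  refine ⟨C₀, hC₀, fun l hl => ?_⟩
  refine hmain (fun i => ((l i : K) : ℂ)) (fun i => ⟨l i, rfl⟩) fun h => hl ?_
  funext i
  have := congrFun h i
  simpa using this
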